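/- Let $n\ge 2$ be an integer and let $\rho\in M_n(\mathbb C)\otimes M_2(\mathbb C)\cong M_{2n}(\mathbb C)$ be a quantum state, i.e. a positive-semidefinite matrix of trace $1$, with eigenvalues (counted with multiplicity) $\lambda_1\ge\lambda_2\ge\cdots\ge\lambda_{2n}\ge 0$. Then the following four conditions are equivalent: 1. $\rho$ is absolutely separable ($\rho\in\mathrm{ASEP}_{n,2}$): for every unitary $U\in M_{2n}(\mathbb C)$, the state $U\rho U^*$ is separable, i.e. of the form $\sum_i p_i\, e_ie_i^*\otimes f_if_i^*$ (a finite sum) with $p_i\ge 0$, $\sum_i p_i=1$ and unit vectors $e_i\in\mathbb C^n$, $f_i\in\mathbb C^2$; 2. $\rho$ is absolutely PPT ($\rho\in\mathrm{APPT}_{n,2}$): for every unitary $U\in M_{2n}(\mathbb C)$, the partial transpose $(\mathrm{id}_n\otimes\Theta)(U\rho U^*)$ is positive-semidefinite, where $\Theta(X)=X^T$ on $M_2(\mathbb C)$; 3. $\rho$ is absolutely RED ($\rho\in\mathrm{ARED}_{n,2}$): for every unitary $U\in M_{2n}(\mathbb C)$, the matrix $(\mathrm{id}_n\otimes R)(U\rho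 U^*)$ is positive-semidefinite, where $R(X)=I_2\,\mathrm{Tr}[X]-X$ is the reduction map on $M_2(\mathbb C)$; 4. $\lambda_1\le\lambda_{2n-1}+2\sqrt{\lambda_{2n-2}\,\lambda_{2n}}$. -/

import Mathlib

open scoped Kronecker ComplexOrder

namespace QuantumBipartite

/-- `D_d` for a finite index type: positive-semidefinite complex matrices of unit trace. -/
def densityMatrices (ι : Type*) [Fintype ι] : Set (Matrix ι ι ℂ) :=
  {ρ | ρ.PosSemidef ∧ ρ.trace = 1}

/-- The bipartite matrix algebra `M_n(ℂ) ⊗ M_k(ℂ) = M_{nk}(ℂ)`; the entry at `((i, a), (j, b))`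
is the coefficient of `E_{ij} ⊗ E_{ab}`. -/
abbrev BipartiteMatrix (n k : ℕ) : Type := Matrix (Fin n × Fin k) (Fin n × Fin k) ℂ

/-- The pure state `v v*` of a vector `v`, i.e. the rank-one operator with entries `v_i * conj v_j`. -/
def pureState {d : ℕ} (v : Fin d → ℂ) : Matrix (Fin d) (Fin d) ℂ :=
  Matrix.vecMulVec v (star v)

/-- `SEP_{n,k}`: finite convex combinations `∑ p_i (e_i e_i*) ⊗ (f_i f_i*)` of pure product states
(`e_i`, `f_i` unit vectors). -/
def SEP (n k : ℕ) : Set (BipartiteMatrix n k) :=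
  convexHull ℝ {ρ | ∃ (e : Fin n → ℂ) (f : Fin k → ℂ),
    star e ⬝ᵥ e = 1 ∧ star f ⬝ᵥ f = 1 ∧ ρ = pureState e ⊗ₖ pureState f}

/-- `id_n ⊗ P`: the linear map `P` acts on each `k × k` block of `X`. -/
def idTensor {n k : ℕ} (P : Matrix (Fin k) (Fin k) ℂ →ₗ[ℂ] Matrix (Fin k) (Fin k) ℂ)
    (X : BipartiteMatrix n k) : BipartiteMatrix n k :=
  Matrix.of fun p q => P (Matrix.of fun a b => X (p.1, a) (q.1, b)) p.2 q.2

/-- On elementary tensors `id_n ⊗ P` acts as expected. -/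
theorem idTensor_kronecker {n k : ℕ}
    (P : Matrix (Fin k) (Fin k) ℂ →ₗ[ℂ] Matrix (Fin k) (Fin k) ℂ)
    (A : Matrix (Fin n) (Fin n) ℂ) (B : Matrix (Fin k) (Fin k) ℂ) :
    idTensor P (A ⊗ₖ B) = A ⊗ₖ P B := by
  ext p q
  have h : (Matrix.of fun a b => (A ⊗ₖ B) (p.1, a) (q.1, b)) = A p.1 q.1 • B := by
    ext a b
    simp [Matrix.kroneckerMap_apply]
  change P (Matrix.of fun a b => (A ⊗ₖ B) (p.1, a) (q.1, b)) p.2 q.2 = A p.1 q.1 * P B p.2 q.2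
  rw [h, map_smul]
  rfl

/-- The reduction map `R(X) = I · Tr X - X` on `M_k(ℂ)`. -/
def reductionMap (k : ℕ) : Matrix (Fin k) (Fin k) ℂ →ₗ[ℂ] Matrix (Fin k) (Fin k) ℂ where
  toFun X := X.trace • (1 : Matrix (Fin k) (Fin k) ℂ) - X
  map_add' X Y := by
    rw [Matrix.trace_add, add_smul]
    abel
  map_smul' c X := by
    simp [Matrix.trace_smul, smul_sub, smul_smul]

/-- The transposition map on `M_k(ℂ)`. -/
def transposeMap (k : ℕ) : Matrix (Fin k) (Fin k) ℂ →ₗ[ℂ] Matrix (Fin k) (Fin k) ℂ where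
  toFun X := X.transpose
  map_add' X Y := Matrix.transpose_add X Y
  map_smul' c X := Matrix.transpose_smul c X

/-- `PPT_{n,k}`: states with positive-semidefinite partial transpose (second factor). -/
def PPT (n k : ℕ) : Set (BipartiteMatrix n k) :=
  {ρ | ρ ∈ densityMatrices (Fin n × Fin k) ∧ (idTensor (transposeMap k) ρ).PosSemidef}

/-- `RED_{n,k}`: states with positive-semidefinite reduction (second factor). -/
def RED (n k : ℕ) : Set (BipartiteMatrix n k) :=
  {ρ | ρ ∈ densityMatrices (Fin n × Fin k) ∧ (idTensor (reductionMap k) ρ).PosSemidef}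

/-- The states which stay in `C` under every global unitary conjugation `ρ ↦ U ρ U*`. -/
def absolutely {n k : ℕ} (C : Set (BipartiteMatrix n k)) : Set (BipartiteMatrix n k) :=
  {ρ | ρ ∈ densityMatrices (Fin n × Fin k) ∧
    ∀ U ∈ Matrix.unitaryGroup (Fin n × Fin k) ℂ, U * ρ * star U ∈ C}

/-- `ASEP_{n,k}`, the absolutely separable states. -/
def ASEP (n k : ℕ) : Set (BipartiteMatrix n k) := absolutely (SEP n k)

/-- `APPT_{n,k}`, the absolutely PPT states. -/
def APPT (n k : ℕ) : Set (BipartiteMatrix n k) := absolutely (PPT n k)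

/-- `ARED_{n,k}`, the absolutely RED states. -/
def ARED (n k : ℕ) : Set (BipartiteMatrix n k) := absolutely (RED n k)

/-- `ev` lists the eigenvalues of `ρ`, with algebraic multiplicity, in decreasing order. The entry
`ev i` for `i : Fin d` is the eigenvalue usually written `λ_{i+1}`. -/
def IsOrderedSpectrum {ι : Type*} [Fintype ι] [DecidableEq ι] {d : ℕ} (ρ : Matrix ι ι ℂ)
    (ev : Fin d → ℝ) : Prop :=
  Antitone ev ∧ ρ.charpoly.roots = Finset.univ.val.map fun i => (ev i : ℂ)

end QuantumBipartite

/-! On a qubit the reduction map is transposition followed by conjugation with a fixed unitary, so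
RED and PPT coincide; and SEP lies in PPT. What remains is the spectral description of APPT and the
passage from APPT to ASEP.

Necessity of the inequality: place the eigenvectors of `λ_{2n}`, `λ_{2n-2}`, `λ_{2n-1}`, `λ_1` at
`e₀⊗f₀`, `e₁⊗f₁`, `(e₀⊗f₁ + e₁⊗f₀)/√2`, `(e₀⊗f₁ - e₁⊗f₀)/√2`. A 2×2 principal minor of the partial
transpose is then `λ_{2n} λ_{2n-2} - ((λ_1 - λ_{2n-1})/2)²` (`spectrum_le_of_mem_APPT`).

Sufficiency: by a Schmidt decomposition, the form of the partial transpose at any vector is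
`s²⟨e₀,ρe₀⟩ + t²⟨e₁,ρe₁⟩ + 2st Re⟨e₂,ρe₃⟩` with orthonormal `e`, apart from degenerate cases.
Polarizing the cross term leaves one vector bounded above by `λ_1` and an orthonormal triple with
weights `s² ≥ st ≥ t²`, whose weighted sum is at least `s²λ_{2n} + stλ_{2n-1} + t²λ_{2n-2}`; the
arithmetic-geometric mean inequality concludes (`weighted_form_nonneg`).

APPT implies separable: write `ρ` in blocks `A`, `B`, `B*`, `C` with respect to the qubit. If `‖B‖²
≤ λ_min(A) λ_min(C)`, then `ρ` is separable, because a contraction is a mean of two unitaries and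
the corresponding blocks built from a unitary split into product states
(`mem_sepCone_of_offDiag_le`). Let `u`, `v` be lowest eigenvectors of `A`, `C` and `x`, `y` a top
singular pair of `B`. If `|⟨x,u⟩| = |⟨y,v⟩|`, some unitary acting on one qubit level aligns these
vectors, and positivity of the partial transpose gives the norm bound
(`sq_re_offDiag_le_of_mem_APPT`). The overlaps are balanced by rotating the qubit basis: a quarter
turn exchanges `A` with `C` and `x` with `y` up to sign, so the difference of overlaps changes sign.
As these vectors need not depend continuously on the angle, the intermediate value theorem is
applied to a compact family with connected fibres (`exists_mem_fibre_eq_zero`). -/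

namespace Matrix

/-! ### Unitary matrices: extension of columns, singular values, diagonalization. -/

variable {ι : Type*} [Fintype ι] [DecidableEq ι]

/-- A partial orthonormal family of columns extends to a unitary matrix. -/
theorem exists_unitary_extend_columns (s : Set ι) (v : ι → ι → ℂ)
    (hv : ∀ i ∈ s, ∀ j ∈ s, star (v i) ⬝ᵥ v j = if i = j then 1 else 0) :
    ∃ U ∈ unitaryGroup ι ℂ, ∀ i ∈ s, ∀ k, U k i = v i k := by
  have h : Orthonormal ℂ (s.domRestrict fun i => (WithLp.toLp 2 (v i) : EuclideanSpace ℂ ι)) := by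
    rw [orthonormal_iff_ite]
    rintro ⟨i, hi⟩ ⟨j, hj⟩
    have := hv i hi j hj
    simp only [Set.domRestrict_apply, EuclideanSpace.inner_eq_star_dotProduct, Subtype.mk.injEq]
    rw [dotProduct_comm]
    exact this
  obtain ⟨b, hb⟩ := h.exists_orthonormalBasis_extension_of_card_eq (by simp)
  refine ⟨(EuclideanSpace.basisFun ι ℂ).toBasis.toMatrix b.toBasis,
    (EuclideanSpace.basisFun ι ℂ).toMatrix_orthonormalBasis_mem_unitary b, fun i hi k => ?_⟩
  have : b i k = v i k := by rw [hb i hi]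
  simpa [Module.Basis.toMatrix_apply] using this

/-- Spectral theorem for Hermitian matrices in product form. -/
theorem IsHermitian.exists_unitary_diagonal {A : Matrix ι ι ℂ} (hA : A.IsHermitian) :
    ∃ U ∈ unitaryGroup ι ℂ, A = U * diagonal (fun i => (hA.eigenvalues i : ℂ)) * Uᴴ := by
  refine ⟨hA.eigenvectorUnitary, hA.eigenvectorUnitary.2, ?_⟩
  conv_lhs => rw [hA.spectral_theorem]
  rfl

/-- Singular value decomposition of a square matrix. -/
theorem exists_singular_value_decomposition (B : Matrix ι ι ℂ) :
    ∃ X ∈ unitaryGroup ι ℂ, ∃ Y ∈ unitaryGroup ι ℂ, ∃ σ : ι → ℝ, (∀ i, 0 ≤ σ i) ∧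
      B = X * diagonal (fun i => (σ i : ℂ)) * Yᴴ := by
  have hP : (Bᴴ * B).PosSemidef := posSemidef_conjTranspose_mul_self B
  obtain ⟨Y, hY, hd⟩ := hP.isHermitian.exists_unitary_diagonal
  set μ := hP.isHermitian.eigenvalues with hμ
  have hμ0 : ∀ i, 0 ≤ μ i := hP.eigenvalues_nonneg
  have hYY : Yᴴ * Y = 1 := mem_unitaryGroup_iff'.1 hY
  have hYY' : Y * Yᴴ = 1 := mem_unitaryGroup_iff.1 hY
  have hM : (B * Y)ᴴ * (B * Y) = diagonal (fun i => (μ i : ℂ)) := by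
    calc (B * Y)ᴴ * (B * Y) = Yᴴ * (Bᴴ * B) * Y := by
          rw [conjTranspose_mul]; simp only [Matrix.mul_assoc]
      _ = (Yᴴ * Y) * diagonal (fun i => (μ i : ℂ)) * (Yᴴ * Y) := by
          rw [hd]; simp only [Matrix.mul_assoc]
      _ = _ := by rw [hYY]; simp
  set M := B * Y with hMdef
  have hcol : ∀ i j, star (fun k => M k i) ⬝ᵥ (fun k => M k j) = if i = j then (μ i : ℂ) else 0 := by
    intro i j
    have := congrFun (congrFun hM i) j
    rw [diagonal_apply] at this
    rw [← this]
    rfl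
  -- The columns of `B * Y` are orthogonal with squared norms `μ`; the nonzero ones are normalized,
  -- and the extension fills in the rest of `X`.
  obtain ⟨X, hX, hXc⟩ := exists_unitary_extend_columns {i | μ i ≠ 0}
    (fun i => ((√(μ i) : ℝ) : ℂ)⁻¹ • fun k => M k i) (by
      intro i hi j hj
      rw [star_smul, smul_dotProduct, dotProduct_smul, hcol]
      split_ifs with h
      · subst h
        have h1 : ((√(μ i) : ℝ) : ℂ) ≠ 0 := by
          rw [Complex.ofReal_ne_zero]
          exact (Real.sqrt_pos.2 (lt_of_le_of_ne (hμ0 i) (Ne.symm hi))).ne'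
        have h2 : (μ i : ℂ) = ((√(μ i) : ℝ) : ℂ) * ((√(μ i) : ℝ) : ℂ) := by
          rw [← Complex.ofReal_mul, Real.mul_self_sqrt (hμ0 i)]
        rw [h2]
        simp only [star_inv₀, RCLike.star_def, Complex.conj_ofReal, smul_eq_mul]
        field_simp
      · simp)
  refine ⟨X, hX, Y, hY, fun i => √(μ i), fun i => Real.sqrt_nonneg _, ?_⟩
  have hMX : M = X * diagonal (fun i => ((√(μ i) : ℝ) : ℂ)) := by
    ext k i
    rw [mul_diagonal]
    by_cases h : μ i = 0
    · have h0 : (fun k => M k i) = 0 := by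
        have := hcol i i
        rw [if_pos rfl, h, Complex.ofReal_zero, dotProduct_star_self_eq_zero] at this
        exact this
      rw [h, Real.sqrt_zero, Complex.ofReal_zero, mul_zero]
      exact congrFun h0 k
    · have h1 : ((√(μ i) : ℝ) : ℂ) ≠ 0 := by
        rw [Complex.ofReal_ne_zero]
        exact (Real.sqrt_pos.2 (lt_of_le_of_ne (hμ0 i) (Ne.symm h))).ne'
      rw [hXc i h k]
      simp only [Pi.smul_apply, smul_eq_mul]
      field_simp
  rw [← hMX, hMdef, Matrix.mul_assoc, hYY', Matrix.mul_one]

/-- Unitary matrices are unitarily diagonalizable (by the Cayley transform). -/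
theorem exists_unitary_diagonalization {U : Matrix ι ι ℂ} (hU : U ∈ unitaryGroup ι ℂ) :
    ∃ G ∈ unitaryGroup ι ℂ, ∃ z : ι → ℂ, (∀ i, ‖z i‖ = 1) ∧ U = G * diagonal z * Gᴴ := by
  have hUU : Uᴴ * U = 1 := mem_unitaryGroup_iff'.1 hU
  -- The circle is infinite and the spectrum finite, so some unit `ω` makes `ω - U` invertible.
  obtain ⟨ω, hω1, hωs⟩ : ∃ ω : ℂ, ‖ω‖ = 1 ∧ ω ∉ spectrum ℂ U := by
    have hinf : (Metric.sphere (0 : ℂ) 1).Infinite := by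
      have hc : IsPreconnected (Metric.sphere (0 : ℂ) 1) :=
        isPreconnected_sphere (by rw [Complex.rank_real_complex]; norm_num) 0 1
      refine hc.infinite_of_nontrivial ⟨1, by simp, -1, by simp, ?_⟩
      intro h
      have := congrArg Complex.re h
      norm_num at this
    obtain ⟨ω, h1, h2⟩ := (hinf.sdiff (finite_spectrum U)).nonempty
    exact ⟨ω, by simpa using h1, h2⟩
  have hωω : star ω * ω = 1 := by
    rw [RCLike.star_def, ← Complex.normSq_eq_conj_mul_self, Complex.normSq_eq_norm_sq, hω1]
    norm_num
  set P : Matrix ι ι ℂ := ω • 1 - U with hP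
  set Q : Matrix ι ι ℂ := ω • 1 + U with hQ
  have hPu : IsUnit P.det := by
    rw [spectrum.mem_iff, not_not, Algebra.algebraMap_eq_smul_one] at hωs
    exact (isUnit_iff_isUnit_det _).1 hωs
  have hcomm : P * Q = Q * P := by
    simp only [hP, hQ, sub_mul, mul_add, add_mul, mul_sub, smul_mul_assoc, mul_smul_comm, one_mul,
      mul_one, smul_sub, smul_add]
    abel
  have hskew : Pᴴ * Q = -(Qᴴ * P) := by
    have e1 : Pᴴ = star ω • 1 - Uᴴ := by simp [hP]
    have e2 : Qᴴ = star ω • 1 + Uᴴ := by simp [hQ]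
    rw [e1, e2, hP, hQ]
    simp only [sub_mul, mul_add, add_mul, mul_sub, hUU, mul_one, smul_mul_assoc, mul_smul_comm,
      one_mul, smul_sub, smul_add, smul_smul, mul_comm ω (star ω), hωω, one_smul]
    abel
  -- `H = i(ω + U)(ω - U)⁻¹` is Hermitian by `hskew`, and inverting the transform gives `U = ω(H -
  -- i)(H + i)⁻¹`, diagonal in an eigenbasis of `H`.
  set H : Matrix ι ι ℂ := Complex.I • (Q * P⁻¹) with hH
  have hPP : P * P⁻¹ = 1 := mul_nonsing_inv P hPu
  have hPP' : P⁻¹ * P = 1 := nonsing_inv_mul P hPu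
  have hHP : P * H = Complex.I • Q := by
    rw [hH, mul_smul_comm, ← Matrix.mul_assoc, hcomm, Matrix.mul_assoc, hPP, Matrix.mul_one]
  have hHP' : H * P = Complex.I • Q := by
    rw [hH, smul_mul_assoc, Matrix.mul_assoc, hPP', Matrix.mul_one]
  have hHerm : H.IsHermitian := by
    have h1 : Pᴴ * (Hᴴ * P) = Pᴴ * (H * P) := by
      rw [← Matrix.mul_assoc, ← conjTranspose_mul, hHP', mul_smul_comm, hskew, conjTranspose_smul,
        smul_mul_assoc, RCLike.star_def, Complex.conj_I, neg_smul, smul_neg]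
    have hPu' : IsUnit Pᴴ.det := by rw [det_conjTranspose]; exact hPu.star
    have h2 : Hᴴ * P = H * P := by
      have := congrArg (fun Z => (Pᴴ)⁻¹ * Z) h1
      simpa only [← Matrix.mul_assoc, nonsing_inv_mul _ hPu', Matrix.one_mul] using this
    have := congrArg (fun Z => Z * P⁻¹) h2
    rw [Matrix.IsHermitian]
    simpa only [Matrix.mul_assoc, hPP, Matrix.mul_one] using this
  obtain ⟨G, hG, hd⟩ := hHerm.exists_unitary_diagonal
  set h := hHerm.eigenvalues
  have hGG : Gᴴ * G = 1 := mem_unitaryGroup_iff'.1 hG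
  have hGG' : G * Gᴴ = 1 := mem_unitaryGroup_iff.1 hG
  have hne : ∀ i, (h i : ℂ) + Complex.I ≠ 0 := by
    intro i hi
    have := congrArg Complex.im hi
    simp at this
  have hHG : H * G = G * diagonal (fun i => (h i : ℂ)) := by
    rw [hd, Matrix.mul_assoc, hGG, Matrix.mul_one]
  refine ⟨G, hG, fun i => ω * ((h i - Complex.I) / (h i + Complex.I)), fun i => ?_, ?_⟩
  · rw [norm_mul, hω1, one_mul, norm_div]
    have : ‖(h i : ℂ) - Complex.I‖ = ‖(h i : ℂ) + Complex.I‖ := by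
      rw [← Complex.norm_conj]; simp [sub_eq_add_neg]
    rw [this, div_self (norm_ne_zero_iff.2 (hne i))]
  · have h1 : U * (H + Complex.I • 1) = ω • (H - Complex.I • 1) := by
      have : ω • H - U * H = Complex.I • Q := by rw [← hHP, hP, sub_mul, smul_mul_assoc, one_mul]
      rw [mul_add, mul_smul_comm Complex.I U 1, mul_one, smul_sub, sub_eq_iff_eq_add.1 this, hQ, smul_add,
        smul_comm ω]
      abel
    have h2 : U * G * diagonal (fun i => (h i : ℂ) + Complex.I) =
        G * diagonal (fun i => ω * ((h i : ℂ) - Complex.I)) := by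
      have e1 : diagonal (fun i => (h i : ℂ) + Complex.I) =
          diagonal (fun i => (h i : ℂ)) + Complex.I • (1 : Matrix ι ι ℂ) := by
        rw [smul_one_eq_diagonal, diagonal_add]
      have e2 : diagonal (fun i => ω * ((h i : ℂ) - Complex.I)) =
          ω • (diagonal (fun i => (h i : ℂ)) - Complex.I • (1 : Matrix ι ι ℂ)) := by
        rw [smul_one_eq_diagonal, diagonal_sub, ← diagonal_smul]; rfl
      rw [e1, e2, mul_smul_comm, Matrix.mul_assoc, mul_add, mul_sub, ← hHG, mul_smul_comm,
        mul_one]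
      calc U * (H * G + Complex.I • G) = (U * (H + Complex.I • 1)) * G := by
            simp [Matrix.mul_assoc, add_mul]
        _ = _ := by rw [h1]; simp [sub_mul]
    have h3 : U * G = G * diagonal (fun i => ω * (((h i : ℂ) - Complex.I) / (h i + Complex.I))) := by
      have := congrArg (fun Z => Z * diagonal (fun i => ((h i : ℂ) + Complex.I)⁻¹)) h2
      simp only [Matrix.mul_assoc, diagonal_mul_diagonal] at this
      simp only [mul_inv_cancel₀ (hne _)] at this
      rw [show (diagonal fun _ : ι => (1 : ℂ)) = 1 from diagonal_one, Matrix.mul_one] at this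
      rw [this]
      simp only [div_eq_mul_inv, mul_assoc]
    rw [← h3, Matrix.mul_assoc, hGG', Matrix.mul_one]

end Matrix

/-! ### Separable states and the cone they span. -/

namespace QuantumBipartite

open Matrix

theorem trace_pureState {d : ℕ} (v : Fin d → ℂ) : (pureState v).trace = star v ⬝ᵥ v := by
  rw [pureState, trace_vecMulVec, dotProduct_comm]

theorem convex_densityMatrices (ι : Type*) [Fintype ι] :
    Convex ℝ (densityMatrices ι) := by
  rintro X ⟨hX, hX1⟩ Y ⟨hY, hY1⟩ a b ha hb hab
  refine ⟨(hX.smul ha).add (hY.smul hb), ?_⟩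
  rw [trace_add, trace_smul, trace_smul, hX1, hY1, ← add_smul, hab, one_smul]

theorem SEP_subset_densityMatrices (n k : ℕ) : SEP n k ⊆ densityMatrices (Fin n × Fin k) := by
  refine convexHull_min ?_ (convex_densityMatrices _)
  rintro _ ⟨e, f, he, hf, rfl⟩
  refine ⟨(posSemidef_vecMulVec_self_star e).kronecker (posSemidef_vecMulVec_self_star f), ?_⟩
  rw [trace_kronecker, trace_pureState, trace_pureState, he, hf, one_mul]

theorem idTensor_add {n k : ℕ} (P : Matrix (Fin k) (Fin k) ℂ →ₗ[ℂ] Matrix (Fin k) (Fin k) ℂ)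
    (X Y : BipartiteMatrix n k) : idTensor P (X + Y) = idTensor P X + idTensor P Y := by
  ext p q
  have : (Matrix.of fun a b => (X + Y) (p.1, a) (q.1, b)) =
      (Matrix.of fun a b => X (p.1, a) (q.1, b)) + Matrix.of fun a b => Y (p.1, a) (q.1, b) := rfl
  change P (Matrix.of fun a b => (X + Y) (p.1, a) (q.1, b)) p.2 q.2 = _
  rw [this, map_add]
  rfl

theorem idTensor_smul {n k : ℕ} (P : Matrix (Fin k) (Fin k) ℂ →ₗ[ℂ] Matrix (Fin k) (Fin k) ℂ)
    (c : ℝ) (X : BipartiteMatrix n k) : idTensor P (c • X) = c • idTensor P X := by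
  ext p q
  have : (Matrix.of fun a b => (c • X) (p.1, a) (q.1, b)) =
      (c : ℂ) • (Matrix.of fun a b => X (p.1, a) (q.1, b)) := by
    ext; simp
  change P (Matrix.of fun a b => (c • X) (p.1, a) (q.1, b)) p.2 q.2 = _
  rw [this, map_smul]
  simp only [Matrix.smul_apply, Complex.real_smul]
  rfl

theorem SEP_subset_PPT (n k : ℕ) : SEP n k ⊆ PPT n k := by
  have hsub : SEP n k ⊆ {X | (idTensor (transposeMap k) X).PosSemidef} := by
    refine convexHull_min ?_ ?_
    · rintro _ ⟨e, f, -, -, rfl⟩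
      rw [Set.mem_ofPred_eq, idTensor_kronecker]
      exact (posSemidef_vecMulVec_self_star e).kronecker
        (posSemidef_vecMulVec_self_star f).transpose
    · intro X hX Y hY a b ha hb _
      rw [Set.mem_ofPred_eq, idTensor_add, idTensor_smul, idTensor_smul]
      exact (PosSemidef.smul hX ha).add (PosSemidef.smul hY hb)
  exact fun X hX => ⟨SEP_subset_densityMatrices n k hX, hsub hX⟩

/-- The cone of unnormalised separable operators. -/
def sepCone (n k : ℕ) : AddSubmonoid (BipartiteMatrix n k) :=
  AddSubmonoid.closure {X | ∃ (P : Matrix (Fin n) (Fin n) ℂ) (Q : Matrix (Fin k) (Fin k) ℂ),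
    P.PosSemidef ∧ Q.PosSemidef ∧ X = P ⊗ₖ Q}

theorem kronecker_mem_sepCone {n k : ℕ} {P : Matrix (Fin n) (Fin n) ℂ}
    {Q : Matrix (Fin k) (Fin k) ℂ} (hP : P.PosSemidef) (hQ : Q.PosSemidef) :
    P ⊗ₖ Q ∈ sepCone n k :=
  AddSubmonoid.subset_closure ⟨P, Q, hP, hQ, rfl⟩

theorem smul_mem_sepCone {n k : ℕ} {X : BipartiteMatrix n k} (hX : X ∈ sepCone n k) {r : ℝ}
    (hr : 0 ≤ r) : r • X ∈ sepCone n k := by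
  induction hX using AddSubmonoid.closure_induction with
  | mem x hx =>
    obtain ⟨P, Q, hP, hQ, rfl⟩ := hx
    rw [← smul_kronecker]
    exact kronecker_mem_sepCone (hP.smul hr) hQ
  | zero => rw [smul_zero]; exact zero_mem _
  | add x y _ _ hx hy => rw [smul_add]; exact add_mem hx hy

/-- Serves to undo a change of qubit basis at the end of the separability argument. -/
theorem conj_mem_sepCone {n k : ℕ} {X : BipartiteMatrix n k} (hX : X ∈ sepCone n k)
    (R : Matrix (Fin k) (Fin k) ℂ) :
    ((1 : Matrix (Fin n) (Fin n) ℂ) ⊗ₖ R) * X * ((1 : Matrix (Fin n) (Fin n) ℂ) ⊗ₖ R)ᴴ ∈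
      sepCone n k := by
  induction hX using AddSubmonoid.closure_induction with
  | mem x hx =>
    obtain ⟨P, Q, hP, hQ, rfl⟩ := hx
    rw [conjTranspose_kronecker, ← mul_kronecker_mul, ← mul_kronecker_mul, conjTranspose_one,
      Matrix.one_mul, Matrix.mul_one]
    exact kronecker_mem_sepCone hP (hQ.mul_mul_conjTranspose_same R)
  | zero => rw [Matrix.mul_zero, Matrix.zero_mul]; exact zero_mem _
  | add x y _ _ hx hy => rw [Matrix.mul_add, Matrix.add_mul]; exact add_mem hx hy

/-- A positive-semidefinite matrix is a finite sum of nonnegative multiples of pure states. -/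
theorem _root_.Matrix.PosSemidef.exists_sum_pureState {d : ℕ} {P : Matrix (Fin d) (Fin d) ℂ}
    (hP : P.PosSemidef) : ∃ (w : Fin d → ℝ) (e : Fin d → Fin d → ℂ), (∀ i, 0 ≤ w i) ∧
      (∀ i, star (e i) ⬝ᵥ e i = 1) ∧ P = ∑ i, w i • pureState (e i) := by
  obtain ⟨U, hU, hd⟩ := hP.isHermitian.exists_unitary_diagonal
  refine ⟨hP.isHermitian.eigenvalues, fun i k => U k i, hP.eigenvalues_nonneg, fun i => ?_, ?_⟩
  · have := congrFun (congrFun (mem_unitaryGroup_iff'.1 hU) i) i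
    rw [one_apply_eq] at this
    exact this
  · conv_lhs => rw [hd]
    ext k l
    rw [mul_apply, Matrix.sum_apply]
    refine Finset.sum_congr rfl fun i _ => ?_
    simp [mul_diagonal, pureState, vecMulVec_apply]
    ring

/-- Spectral decomposition of both tensor factors reduces generators to pure product states, and a
sum of multiples is renormalized by its total weight. Positive dimensions provide a state to
accompany the weight `0`. -/
theorem exists_smul_mem_SEP {n k : ℕ} (hn : 0 < n) (hk : 0 < k) {X : BipartiteMatrix n k}
    (hX : X ∈ sepCone n k) : ∃ r : ℝ, 0 ≤ r ∧ ∃ Y ∈ SEP n k, X = r • Y := by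
  have hpure : ∀ (e : Fin n → ℂ) (f : Fin k → ℂ), star e ⬝ᵥ e = 1 → star f ⬝ᵥ f = 1 →
      pureState e ⊗ₖ pureState f ∈ SEP n k :=
    fun e f he hf => subset_convexHull ℝ _ ⟨e, f, he, hf, rfl⟩
  have hzero : ∃ r : ℝ, 0 ≤ r ∧ ∃ Y ∈ SEP n k, (0 : BipartiteMatrix n k) = r • Y :=
    ⟨0, le_rfl, _, hpure (Pi.single ⟨0, hn⟩ 1) (Pi.single ⟨0, hk⟩ 1) (by simp) (by simp),
      (zero_smul _ _).symm⟩
  have hadd : ∀ x y : BipartiteMatrix n k, (∃ r : ℝ, 0 ≤ r ∧ ∃ Y ∈ SEP n k, x = r • Y) →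
      (∃ r : ℝ, 0 ≤ r ∧ ∃ Y ∈ SEP n k, y = r • Y) →
      ∃ r : ℝ, 0 ≤ r ∧ ∃ Y ∈ SEP n k, x + y = r • Y := by
    rintro _ _ ⟨r, hr, Y, hY, rfl⟩ ⟨s, hs, Z, hZ, rfl⟩
    rcases eq_or_lt_of_le (add_nonneg hr hs) with h | h
    · have hr0 : r = 0 := by linarith
      have hs0 : s = 0 := by linarith
      rw [hr0, hs0, zero_smul, zero_smul, add_zero]
      exact hzero
    · refine ⟨r + s, h.le, (r / (r + s)) • Y + (s / (r + s)) • Z,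
        convex_convexHull ℝ _ hY hZ (by positivity) (by positivity) (by field_simp), ?_⟩
      rw [smul_add, smul_smul, smul_smul, mul_div_cancel₀ _ h.ne', mul_div_cancel₀ _ h.ne']
  induction hX using AddSubmonoid.closure_induction with
  | mem x hx =>
    obtain ⟨P, Q, hP, hQ, rfl⟩ := hx
    obtain ⟨w, e, hw, he, rfl⟩ := hP.exists_sum_pureState
    obtain ⟨w', f, hw', hf, rfl⟩ := hQ.exists_sum_pureState
    have : (∑ i, w i • pureState (e i)) ⊗ₖ (∑ j, w' j • pureState (f j)) =
        ∑ i, ∑ j, (w i * w' j) • (pureState (e i) ⊗ₖ pureState (f j)) := by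
      ext p q
      simp only [kroneckerMap_apply, Matrix.sum_apply, Matrix.smul_apply, Finset.sum_mul_sum, Complex.real_smul,
        Complex.ofReal_mul]
      exact Finset.sum_congr rfl fun i _ => Finset.sum_congr rfl fun j _ => by ring
    rw [this]
    refine Finset.sum_induction _ (fun x => ∃ r : ℝ, 0 ≤ r ∧ ∃ Y ∈ SEP n k, x = r • Y)
      hadd hzero fun i _ => ?_
    refine Finset.sum_induction _ (fun x => ∃ r : ℝ, 0 ≤ r ∧ ∃ Y ∈ SEP n k, x = r • Y)
      hadd hzero fun j _ => ?_
    exact ⟨w i * w' j, mul_nonneg (hw i) (hw' j), _, hpure _ _ (he i) (hf j), rfl⟩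
  | zero => exact hzero
  | add x y _ _ hx hy => exact hadd x y hx hy

theorem mem_SEP_of_mem_sepCone {n k : ℕ} (hn : 0 < n) (hk : 0 < k) {X : BipartiteMatrix n k}
    (hX : X ∈ sepCone n k) (htr : X.trace = 1) : X ∈ SEP n k := by
  obtain ⟨r, -, Y, hY, rfl⟩ := exists_smul_mem_SEP hn hk hX
  rw [trace_smul, (SEP_subset_densityMatrices n k hY).2, Complex.real_smul, mul_one] at htr
  have hr : r = 1 := by exact_mod_cast htr
  rwa [hr, one_smul]

/-! ### A separability criterion in terms of qubit blocks. -/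

/-- The `n × n` blocks of a matrix on `ℂⁿ ⊗ ℂ²` with respect to the qubit. -/
def qubitBlock {n : ℕ} (X : BipartiteMatrix n 2) (a b : Fin 2) : Matrix (Fin n) (Fin n) ℂ :=
  Matrix.of fun i j => X (i, a) (j, b)

/-- In an eigenbasis `g_k` of `U`, with eigenvalues `z_k`, the matrix becomes the sum of `g_k g_k* ⊗
f_k f_k*` where `f_k = (√a z_k, √c)`. -/
theorem block_unitary_mem_sepCone {n : ℕ} {U : Matrix (Fin n) (Fin n) ℂ}
    (hU : U ∈ unitaryGroup (Fin n) ℂ) {a c : ℝ} (ha : 0 ≤ a) (hc : 0 ≤ c)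
    {X : BipartiteMatrix n 2} (h00 : qubitBlock X 0 0 = (a : ℂ) • 1)
    (h01 : qubitBlock X 0 1 = ((√a * √c : ℝ) : ℂ) • U)
    (h10 : qubitBlock X 1 0 = ((√a * √c : ℝ) : ℂ) • Uᴴ)
    (h11 : qubitBlock X 1 1 = (c : ℂ) • 1) : X ∈ sepCone n 2 := by
  obtain ⟨G, hG, z, hz, rfl⟩ := exists_unitary_diagonalization hU
  have hGG : G * Gᴴ = 1 := mem_unitaryGroup_iff.1 hG
  have hzz : ∀ k, z k * star (z k) = 1 := fun k => by
    rw [RCLike.star_def, Complex.mul_conj, Complex.normSq_eq_norm_sq, hz]; norm_num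
  have haa : (√a : ℂ) * √a = a := by rw [← Complex.ofReal_mul, Real.mul_self_sqrt ha]
  have hcc : (√c : ℂ) * √c = c := by rw [← Complex.ofReal_mul, Real.mul_self_sqrt hc]
  have hX : X = ∑ k, pureState (fun i => G i k) ⊗ₖ pureState ![(√a : ℂ) * z k, (√c : ℂ)] := by
    have hent : ∀ i j, ∑ k, G i k * star (G j k) = (1 : Matrix (Fin n) (Fin n) ℂ) i j := fun i j => by
      rw [← hGG]; rfl
    ext ⟨i, s⟩ ⟨j, t⟩
    have hs : ∀ s t, X (i, s) (j, t) = qubitBlock X s t i j := fun _ _ => rfl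
    rw [hs, Matrix.sum_apply]
    simp only [kroneckerMap_apply, pureState, vecMulVec_apply, Pi.star_apply]
    fin_cases s <;> fin_cases t <;>
      simp only [Fin.zero_eta, Fin.mk_one, h00, h01, h10, h11, Matrix.smul_apply, smul_eq_mul,
        cons_val_zero, cons_val_one]
    · rw [← hent, Finset.mul_sum]
      refine Finset.sum_congr rfl fun k _ => ?_
      rw [star_mul', ← haa]
      simp only [RCLike.star_def, Complex.conj_ofReal]
      have := hzz k
      rw [RCLike.star_def] at this
      linear_combination (-(√a : ℂ) * √a * G i k * (starRingEnd ℂ) (G j k)) * this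
    · rw [mul_apply, Finset.mul_sum]
      refine Finset.sum_congr rfl fun k _ => ?_
      simp only [mul_diagonal, conjTranspose_apply, RCLike.star_def, Complex.conj_ofReal,
        Complex.ofReal_mul]
      ring
    · rw [conjTranspose_apply, mul_apply, star_sum, Finset.mul_sum]
      refine Finset.sum_congr rfl fun k _ => ?_
      simp only [mul_diagonal, conjTranspose_apply, RCLike.star_def, Complex.conj_ofReal,
        Complex.ofReal_mul, map_mul, Complex.conj_conj]
      ring
    · rw [← hent, Finset.mul_sum]
      refine Finset.sum_congr rfl fun k _ => ?_
      rw [← hcc]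
      simp only [RCLike.star_def, Complex.conj_ofReal]
      ring
  rw [hX]
  exact sum_mem fun k _ => kronecker_mem_sepCone (posSemidef_vecMulVec_self_star _)
    (posSemidef_vecMulVec_self_star _)

/-- A Hermitian block matrix whose off-diagonal block is dominated in operator norm by the
geometric mean of lower bounds of the diagonal blocks is separable. -/
theorem mem_sepCone_of_offDiag_le {n : ℕ} {X : BipartiteMatrix n 2} (hX : X.IsHermitian)
    {a c : ℝ} (ha : 0 ≤ a) (hc : 0 ≤ c) (hA : (qubitBlock X 0 0 - (a : ℂ) • 1).PosSemidef)
    (hC : (qubitBlock X 1 1 - (c : ℂ) • 1).PosSemidef)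
    (hB : ∀ x y : Fin n → ℂ, 2 * (star x ⬝ᵥ qubitBlock X 0 1 *ᵥ y).re ≤
      √a * √c * ((star x ⬝ᵥ x).re + (star y ⬝ᵥ y).re)) :
    X ∈ sepCone n 2 := by
  obtain ⟨V, hV, Y, hY, σ, hσ, hsvd⟩ := exists_singular_value_decomposition (qubitBlock X 0 1)
  have hVV : Vᴴ * V = 1 := mem_unitaryGroup_iff'.1 hV
  have hYY : Yᴴ * Y = 1 := mem_unitaryGroup_iff'.1 hY
  set t := √a * √c with ht
  have ht0 : 0 ≤ t := by positivity
  have hσt : ∀ i, σ i ≤ t := by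
    intro i
    -- Testing the bound on the `i`-th singular pair gives `2σ_i ≤ 2t`.
    have h1 := hB (V *ᵥ Pi.single i 1) (Y *ᵥ Pi.single i 1)
    have e1 : star (V *ᵥ Pi.single i 1) ⬝ᵥ (V *ᵥ Pi.single i 1) = (1 : ℂ) := by
      rw [star_mulVec, dotProduct_mulVec, vecMul_vecMul, hVV, vecMul_one]
      simp
    have e2 : star (Y *ᵥ Pi.single i 1) ⬝ᵥ (Y *ᵥ Pi.single i 1) = (1 : ℂ) := by
      rw [star_mulVec, dotProduct_mulVec, vecMul_vecMul, hYY, vecMul_one]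
      simp
    have e3 : star (V *ᵥ Pi.single i 1) ⬝ᵥ qubitBlock X 0 1 *ᵥ (Y *ᵥ Pi.single i 1) = (σ i : ℂ) := by
      rw [hsvd, mulVec_mulVec, Matrix.mul_assoc, Matrix.mul_assoc, hYY, Matrix.mul_one, star_mulVec,
        dotProduct_mulVec, vecMul_vecMul, ← Matrix.mul_assoc, hVV, Matrix.one_mul]
      simp
    rw [e1, e2, e3] at h1
    simp only [Complex.ofReal_re, Complex.one_re] at h1
    linarith
  -- With `σ = t cos η = t(e^{iη} + e^{-iη})/2`, the block `B` is `t` times the mean of the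
  -- unitaries `U₁` and `U₂`. If `t = 0`, all `σ i` vanish and the angle is immaterial.
  set η : Fin n → ℝ := fun i => Real.arccos (σ i / t) with hη
  have hcos : ∀ i, t * Real.cos (η i) = σ i := by
    intro i
    rcases eq_or_lt_of_le ht0 with h | h
    · rw [← h, zero_mul]
      exact le_antisymm (hσ i) (by rw [h]; exact hσt i)
    · rw [hη, Real.cos_arccos]
      · field_simp
      · exact le_trans (by norm_num) (div_nonneg (hσ i) ht0)
      · rw [div_le_one h]; exact hσt i
  have hUmem : ∀ z : Fin n → ℂ, (∀ i, z i * star (z i) = 1) →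
      V * diagonal z * Yᴴ ∈ unitaryGroup (Fin n) ℂ := by
    intro z hz
    have hd : diagonal z ∈ unitaryGroup (Fin n) ℂ := by
      rw [mem_unitaryGroup_iff, star_eq_conjTranspose, diagonal_conjTranspose,
        diagonal_mul_diagonal, ← diagonal_one]
      exact congrArg diagonal (funext hz)
    exact mul_mem (mul_mem hV hd) (Unitary.star_mem hY)
  have hexp : ∀ θ : ℝ, Complex.exp (θ * Complex.I) * star (Complex.exp (θ * Complex.I)) = 1 := by
    intro θ
    rw [RCLike.star_def, Complex.mul_conj, Complex.normSq_eq_norm_sq, Complex.norm_exp_ofReal_mul_I]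
    norm_num
  set U₁ := V * diagonal (fun i => Complex.exp ((η i : ℝ) * Complex.I)) * Yᴴ with hU₁
  set U₂ := V * diagonal (fun i => Complex.exp ((-η i : ℝ) * Complex.I)) * Yᴴ with hU₂
  have hU₁m : U₁ ∈ unitaryGroup (Fin n) ℂ := hUmem _ fun i => hexp _
  have hU₂m : U₂ ∈ unitaryGroup (Fin n) ℂ := hUmem _ fun i => hexp _
  have hsum : qubitBlock X 0 1 = ((1 / 2 : ℝ) : ℂ) • (t : ℂ) • (U₁ + U₂) := by
    rw [hsvd, hU₁, hU₂, ← Matrix.add_mul, ← Matrix.mul_add, diagonal_add, smul_smul,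
      ← Matrix.smul_mul, ← Matrix.mul_smul, ← diagonal_smul]
    congr 3
    funext i
    simp only [Pi.smul_apply, smul_eq_mul]
    rw [Complex.ofReal_neg, ← Complex.two_cos, ← Complex.ofReal_cos, ← hcos i]
    push_cast
    ring
  have h10 : qubitBlock X 1 0 = (qubitBlock X 0 1)ᴴ := by
    ext i j
    exact (hX.apply (i, 1) (j, 0)).symm
  let M : Matrix (Fin n) (Fin n) ℂ → BipartiteMatrix n 2 := fun U =>
    Matrix.of fun p q => (!![(a : ℂ) • (1 : Matrix (Fin n) (Fin n) ℂ), (t : ℂ) • U;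
      (t : ℂ) • Uᴴ, (c : ℂ) • (1 : Matrix (Fin n) (Fin n) ℂ)] p.2 q.2) p.1 q.1
  have hM : ∀ U ∈ unitaryGroup (Fin n) ℂ, M U ∈ sepCone n 2 := fun U hU =>
    block_unitary_mem_sepCone hU ha hc rfl rfl rfl rfl
  -- The excess of the diagonal blocks over `a` and `c` is a sum of product terms; the rest is the
  -- mean of two matrices with unitary off-diagonal blocks.
  have hdec : X = (qubitBlock X 0 0 - (a : ℂ) • 1) ⊗ₖ diagonal ![1, 0] +
      (qubitBlock X 1 1 - (c : ℂ) • 1) ⊗ₖ diagonal ![0, 1] +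
      ((1 / 2 : ℝ) • M U₁ + (1 / 2 : ℝ) • M U₂) := by
    ext ⟨i, s⟩ ⟨j, r⟩
    have hs : ∀ s r, X (i, s) (j, r) = qubitBlock X s r i j := fun _ _ => rfl
    rw [hs]
    simp only [Matrix.add_apply, kroneckerMap_apply, Matrix.smul_apply, M, of_apply]
    fin_cases s <;> fin_cases r <;> simp [h10, hsum] <;> ring
  have hdiag : ∀ v : Fin 2 → ℂ, 0 ≤ v → (diagonal v).PosSemidef := fun v hv =>
    PosSemidef.diagonal hv
  rw [hdec]
  refine add_mem (add_mem (kronecker_mem_sepCone hA (hdiag _ ?_))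
    (kronecker_mem_sepCone hC (hdiag _ ?_)))
    (add_mem (smul_mem_sepCone (hM _ hU₁m) (by norm_num)) (smul_mem_sepCone (hM _ hU₂m) (by norm_num)))
  all_goals intro i; fin_cases i <;> simp

end QuantumBipartite

/-! ### Lower bounds for weighted sums of quadratic forms. -/

section FormBounds

open scoped InnerProductSpace
open RCLike (re)

variable {E : Type*} [NormedAddCommGroup E] [InnerProductSpace ℂ E]

/-- A Ky Fan type estimate. In the application `p`, `q`, `r` are the three lowest eigenvalues in
decreasing order, `φ`, `χ` are eigenvectors for `q`, `r`, and `l` is the largest eigenvalue. The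
weights satisfy `s² ≥ st ≥ t²`, so the least sum over an orthonormal triple pairs the largest weight
with `r` and the smallest with `p`. The inequality `s²r + t²p ≥ 2st√(pr)` then absorbs the term in
`l`. -/
theorem weighted_form_nonneg {T : E →ₗ[ℂ] E} {φ χ : E} (hφ : ‖φ‖ = 1) (hχ : ‖χ‖ = 1)
    (hφχ : ⟪φ, χ⟫_ℂ = 0) {p q r l : ℝ} (hr : 0 ≤ r) (hrq : r ≤ q) (hqp : q ≤ p)
    (hlow : ∀ z, p * ‖z‖ ^ 2 - (p - q) * ‖⟪z, φ⟫_ℂ‖ ^ 2 - (p - r) * ‖⟪z, χ⟫_ℂ‖ ^ 2 ≤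
      re ⟪z, T z⟫_ℂ)
    (hup : ∀ z, re ⟪z, T z⟫_ℂ ≤ l * ‖z‖ ^ 2) (hl : l ≤ q + 2 * √(p * r))
    {e : Fin 3 → E} (he : Orthonormal ℂ e) {f : E} (hf : ‖f‖ = 1) {s t : ℝ} (ht : 0 ≤ t)
    (hts : t ≤ s) :
    0 ≤ s ^ 2 * re ⟪e 0, T (e 0)⟫_ℂ + t ^ 2 * re ⟪e 1, T (e 1)⟫_ℂ +
      s * t * (re ⟪e 2, T (e 2)⟫_ℂ - re ⟪f, T f⟫_ℂ) := by
  have hpair : ∀ i, ‖⟪e i, φ⟫_ℂ‖ ^ 2 + ‖⟪e i, χ⟫_ℂ‖ ^ 2 ≤ 1 := by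
    intro i
    have ho : Orthonormal ℂ ![φ, χ] := by
      rw [orthonormal_iff_ite]
      intro a b
      have h2 : ⟪χ, φ⟫_ℂ = 0 := inner_eq_zero_symm.1 hφχ
      fin_cases a <;> fin_cases b <;> simp [hφχ, h2, hφ, hχ]
    have := ho.sum_inner_products_le (e i) (s := Finset.univ)
    rw [Fin.sum_univ_two, he.1 i] at this
    simpa [norm_inner_symm] using this
  have hB1 := he.sum_inner_products_le φ (s := Finset.univ)
  have hB2 := he.sum_inner_products_le χ (s := Finset.univ)
  rw [Fin.sum_univ_three, hφ] at hB1
  rw [Fin.sum_univ_three, hχ] at hB2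
  have l0 := hlow (e 0)
  have l1 := hlow (e 1)
  have l2 := hlow (e 2)
  have lf := hup f
  rw [he.1] at l0 l1 l2
  rw [hf] at lf
  have p0 := hpair 0
  have p1 := hpair 1
  have p2 := hpair 2
  have ha0 := sq_nonneg ‖⟪e 0, φ⟫_ℂ‖
  have ha1 := sq_nonneg ‖⟪e 1, φ⟫_ℂ‖
  have ha2 := sq_nonneg ‖⟪e 2, φ⟫_ℂ‖
  have hb0 := sq_nonneg ‖⟪e 0, χ⟫_ℂ‖
  have hb1 := sq_nonneg ‖⟪e 1, χ⟫_ℂ‖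
  have hb2 := sq_nonneg ‖⟪e 2, χ⟫_ℂ‖
  set a0 := ‖⟪e 0, φ⟫_ℂ‖ ^ 2
  set a1 := ‖⟪e 1, φ⟫_ℂ‖ ^ 2
  set a2 := ‖⟪e 2, φ⟫_ℂ‖ ^ 2
  set b0 := ‖⟪e 0, χ⟫_ℂ‖ ^ 2
  set b1 := ‖⟪e 1, χ⟫_ℂ‖ ^ 2
  set b2 := ‖⟪e 2, χ⟫_ℂ‖ ^ 2
  have hs : 0 ≤ s := ht.trans hts
  have hst : 0 ≤ s * t := mul_nonneg hs ht
  have hw1 : 0 ≤ s ^ 2 - s * t := by nlinarith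
  have hw2 : 0 ≤ s * t - t ^ 2 := by nlinarith
  have m0 := mul_le_mul_of_nonneg_left l0 (sq_nonneg s)
  have m1 := mul_le_mul_of_nonneg_left l1 (sq_nonneg t)
  have m2 := mul_le_mul_of_nonneg_left l2 hst
  have mf := mul_le_mul_of_nonneg_left lf hst
  have ml := mul_le_mul_of_nonneg_left hl hst
  -- Bessel for `χ` and for the pair `φ, χ` bounds the weighted overlaps by the largest weight,
  -- respectively by the sum of the two largest.
  have hY : s ^ 2 * b0 + t ^ 2 * b1 + s * t * b2 ≤ s ^ 2 := by
    have h1 : (s ^ 2 - s * t) * (b1 + b2) ≥ 0 := mul_nonneg hw1 (by linarith)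
    have h2 : (s * t - t ^ 2) * b1 ≥ 0 := mul_nonneg hw2 hb1
    have h3 : s ^ 2 * (b0 + b1 + b2) ≤ s ^ 2 * 1 ^ 2 := mul_le_mul_of_nonneg_left hB2 (sq_nonneg s)
    linarith
  have hXY : s ^ 2 * (a0 + b0) + t ^ 2 * (a1 + b1) + s * t * (a2 + b2) ≤ s ^ 2 + s * t := by
    have h1 : (s ^ 2 - s * t) * (1 - (a0 + b0)) ≥ 0 := mul_nonneg hw1 (by linarith)
    have h2 : (s * t - t ^ 2) * (a1 + b1) ≥ 0 := mul_nonneg hw2 (by linarith)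
    have h3 : s * t * ((a0 + a1 + a2) + (b0 + b1 + b2)) ≤ s * t * (1 ^ 2 + 1 ^ 2) :=
      mul_le_mul_of_nonneg_left (by linarith) hst
    linarith
  -- Abel summation: `(p-q)A + (p-r)B = (p-q)(A+B) + (q-r)B` for the weighted overlaps `A` with `φ`
  -- and `B` with `χ`.
  have n1 := mul_le_mul_of_nonneg_left hY (sub_nonneg.2 hrq)
  have n2 := mul_le_mul_of_nonneg_left hXY (sub_nonneg.2 hqp)
  have hp : 0 ≤ p := hr.trans (hrq.trans hqp)
  have hAG : 2 * (s * t) * √(p * r) ≤ s ^ 2 * r + t ^ 2 * p := by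
    have h1 : √(p * r) = √p * √r := Real.sqrt_mul hp r
    have h2 := Real.sq_sqrt hp
    have h3 := Real.sq_sqrt hr
    rw [h1]
    nlinarith [sq_nonneg (s * √r - t * √p)]
  linarith

/-- Polarization: `2 Re⟨e₂,Te₃⟩` is the form at `(e₂+e₃)/√2` minus the form at `(e₂-e₃)/√2`. The
first vector completes `e₀, e₁` to an orthonormal triple; the second only needs the upper bound. -/
theorem two_pair_form_nonneg_aux {T : E →ₗ[ℂ] E} (hT : T.IsSymmetric) {φ χ : E} (hφ : ‖φ‖ = 1)
    (hχ : ‖χ‖ = 1) (hφχ : ⟪φ, χ⟫_ℂ = 0) {p q r l : ℝ} (hr : 0 ≤ r) (hrq : r ≤ q) (hqp : q ≤ p)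
    (hlow : ∀ z, p * ‖z‖ ^ 2 - (p - q) * ‖⟪z, φ⟫_ℂ‖ ^ 2 - (p - r) * ‖⟪z, χ⟫_ℂ‖ ^ 2 ≤
      re ⟪z, T z⟫_ℂ)
    (hup : ∀ z, re ⟪z, T z⟫_ℂ ≤ l * ‖z‖ ^ 2) (hl : l ≤ q + 2 * √(p * r))
    {e : Fin 4 → E} (he : Orthonormal ℂ e) {s t : ℝ} (ht : 0 ≤ t) (hts : t ≤ s) :
    0 ≤ s ^ 2 * re ⟪e 0, T (e 0)⟫_ℂ + t ^ 2 * re ⟪e 1, T (e 1)⟫_ℂ +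
      2 * (s * t) * re ⟪e 2, T (e 3)⟫_ℂ := by
  have hin : ∀ i j, ⟪e i, e j⟫_ℂ = if i = j then 1 else 0 := orthonormal_iff_ite.1 he
  set c : ℂ := Complex.ofReal (√2)⁻¹ with hc
  have hcc : starRingEnd ℂ c = c := Complex.conj_ofReal _
  have hc2 : c * c = 1 / 2 := by
    rw [hc, ← Complex.ofReal_mul, ← mul_inv, Real.mul_self_sqrt (by norm_num)]
    norm_num
  have ho : Orthonormal ℂ ![e 0, e 1, c • (e 2 + e 3)] := by
    rw [orthonormal_iff_ite]
    intro i j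
    fin_cases i <;> fin_cases j <;>
      simp [inner_add_left, inner_add_right, inner_smul_left, inner_smul_right, hin, hcc,
        -inner_self_eq_norm_sq_to_K]
    linear_combination 2 * hc2
  have hf : ‖c • (e 2 - e 3)‖ = 1 := by
    have : ⟪c • (e 2 - e 3), c • (e 2 - e 3)⟫_ℂ = 1 := by
      simp only [inner_sub_left, inner_sub_right, inner_smul_left, inner_smul_right, hin, hcc]
      simp
      linear_combination 2 * hc2
    have h2 := inner_self_eq_norm_sq (𝕜 := ℂ) (c • (e 2 - e 3))
    rw [this, RCLike.one_re] at h2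
    exact (pow_eq_one_iff_of_nonneg (norm_nonneg _) two_ne_zero).1 h2.symm
  have key := weighted_form_nonneg hφ hχ hφχ hr hrq hqp hlow hup hl ho hf ht hts
  have hpol : re ⟪c • (e 2 + e 3), T (c • (e 2 + e 3))⟫_ℂ -
      re ⟪c • (e 2 - e 3), T (c • (e 2 - e 3))⟫_ℂ = 2 * re ⟪e 2, T (e 3)⟫_ℂ := by
    have hsymm : re ⟪e 3, T (e 2)⟫_ℂ = re ⟪e 2, T (e 3)⟫_ℂ := by
      rw [← hT, ← inner_conj_symm, RCLike.conj_re]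
    have : ⟪c • (e 2 + e 3), T (c • (e 2 + e 3))⟫_ℂ -
      ⟪c • (e 2 - e 3), T (c • (e 2 - e 3))⟫_ℂ = ⟪e 2, T (e 3)⟫_ℂ + ⟪e 3, T (e 2)⟫_ℂ := by
      simp only [map_smul, map_add, map_sub, inner_add_left, inner_add_right, inner_smul_left,
        inner_smul_right, inner_sub_left, inner_sub_right, hcc]
      linear_combination 2 * (⟪e 2, T (e 3)⟫_ℂ + ⟪e 3, T (e 2)⟫_ℂ) * hc2
    rw [← map_sub, this, map_add, hsymm]
    ring
  simp only [Matrix.cons_val_zero, Matrix.cons_val_one, Matrix.cons_val] at key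
  rw [hpol] at key
  linarith

/-- Passes from the Schmidt vectors, of length `s a`, to unit vectors. A vanishing coefficient
leaves one diagonal term, nonnegative by `hT0`; otherwise the larger coefficient takes the role of
`s`, which costs an exchange of the two index values. -/
theorem two_pair_form_nonneg {T : E →ₗ[ℂ] E} (hT : T.IsSymmetric) {φ χ : E} (hφ : ‖φ‖ = 1)
    (hχ : ‖χ‖ = 1) (hφχ : ⟪φ, χ⟫_ℂ = 0) {p q r l : ℝ} (hr : 0 ≤ r) (hrq : r ≤ q) (hqp : q ≤ p)
    (hlow : ∀ z, p * ‖z‖ ^ 2 - (p - q) * ‖⟪z, φ⟫_ℂ‖ ^ 2 - (p - r) * ‖⟪z, χ⟫_ℂ‖ ^ 2 ≤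
      re ⟪z, T z⟫_ℂ)
    (hup : ∀ z, re ⟪z, T z⟫_ℂ ≤ l * ‖z‖ ^ 2) (hl : l ≤ q + 2 * √(p * r))
    (hT0 : ∀ z, 0 ≤ re ⟪z, T z⟫_ℂ)
    {h : Fin 2 → Fin 2 → E} {s : Fin 2 → ℝ} (hs : ∀ a, 0 ≤ s a)
    (hh : ∀ a b c d, ⟪h a b, h c d⟫_ℂ = if a = c ∧ b = d then ((s a ^ 2 : ℝ) : ℂ) else 0) :
    0 ≤ re ⟪h 0 0, T (h 0 0)⟫_ℂ + re ⟪h 1 1, T (h 1 1)⟫_ℂ + 2 * re ⟪h 0 1, T (h 1 0)⟫_ℂ := by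
  have hzero : ∀ a b, s a = 0 → h a b = 0 := by
    intro a b ha
    have := hh a b a b
    rw [if_pos ⟨rfl, rfl⟩, ha] at this
    simpa using this
  by_cases h0 : s 0 = 0
  · rw [hzero 0 0 h0, hzero 0 1 h0]
    simpa using hT0 (h 1 1)
  by_cases h1 : s 1 = 0
  · rw [hzero 1 1 h1, hzero 1 0 h1]
    simpa using hT0 (h 0 0)
  have hne : ∀ a, (s a : ℂ) ≠ 0 := by
    intro a; fin_cases a
    · exact Complex.ofReal_ne_zero.2 h0
    · exact Complex.ofReal_ne_zero.2 h1
  let u : Fin 2 → Fin 2 → E := fun a b => (s a : ℂ)⁻¹ • h a b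
  have hu : ∀ a b, h a b = (s a : ℂ) • u a b := fun a b => by
    simp only [u]; rw [smul_inv_smul₀ (hne a)]
  have huu : ∀ a b c d, ⟪u a b, u c d⟫_ℂ = if a = c ∧ b = d then 1 else 0 := by
    intro a b c d
    simp only [u, inner_smul_left, inner_smul_right, hh]
    split_ifs with hab
    · obtain ⟨rfl, rfl⟩ := hab
      have := hne a
      simp only [map_inv₀, Complex.conj_ofReal]
      push_cast
      field_simp
    · simp
  have hsymm : re ⟪u 1 0, T (u 0 1)⟫_ℂ = re ⟪u 0 1, T (u 1 0)⟫_ℂ := by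
    rw [← hT, ← inner_conj_symm, RCLike.conj_re]
  have e0 : ∀ a b c d, re ⟪h a b, T (h c d)⟫_ℂ = s a * s c * re ⟪u a b, T (u c d)⟫_ℂ := by
    intro a b c d
    rw [hu, hu c d, map_smul, inner_smul_left, inner_smul_right, Complex.conj_ofReal, ← mul_assoc,
      ← Complex.ofReal_mul]
    exact Complex.re_ofReal_mul _ _
  rw [e0, e0, e0]
  have hort : ∀ i₀ j₀ i₁ j₁ i₂ j₂ i₃ j₃ : Fin 2, Function.Injective
      ![(i₀, j₀), (i₁, j₁), (i₂, j₂), (i₃, j₃)] →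
      Orthonormal ℂ ![u i₀ j₀, u i₁ j₁, u i₂ j₂, u i₃ j₃] := by
    intro i₀ j₀ i₁ j₁ i₂ j₂ i₃ j₃ hinj
    have ho : Orthonormal ℂ (fun x : Fin 2 × Fin 2 => u x.1 x.2) := by
      rw [orthonormal_iff_ite]
      rintro ⟨a, b⟩ ⟨c, d⟩
      simp [huu]
    convert ho.comp _ hinj using 1
    funext i
    fin_cases i <;> rfl
  rcases le_total (s 1) (s 0) with hle | hle
  · have := two_pair_form_nonneg_aux hT hφ hχ hφχ hr hrq hqp hlow hup hl
      (hort 0 0 1 1 0 1 1 0 (by decide)) (hs 1) hle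
    simp only [Matrix.cons_val_zero, Matrix.cons_val_one, Matrix.cons_val] at this
    linarith
  · have := two_pair_form_nonneg_aux hT hφ hχ hφχ hr hrq hqp hlow hup hl
      (hort 1 1 0 0 1 0 0 1 (by decide)) (hs 0) hle
    simp only [Matrix.cons_val_zero, Matrix.cons_val_one, Matrix.cons_val] at this
    rw [hsymm] at this
    linarith

end FormBounds

/-! ### From the eigenvalue inequality to positive partial transpose. -/

namespace QuantumBipartite

open Matrix

/-- Equal multisets of values mean fibres of equal cardinality, which can be matched one by one. -/
theorem exists_equiv_of_map_univ_eq {α β γ : Type*} [Fintype α] [Fintype β] {f : α → γ} {g : β → γ}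
    (h : Finset.univ.val.map f = Finset.univ.val.map g) : ∃ e : α ≃ β, ∀ a, g (e a) = f a := by
  classical
  have hcard : ∀ c, Fintype.card {a // f a = c} = Fintype.card {b // g b = c} := by
    intro c
    have := congrArg (Multiset.count c) h
    rw [Multiset.count_map, Multiset.count_map] at this
    rw [Fintype.card_subtype, Fintype.card_subtype]
    simpa [Finset.card_def, Finset.filter_val, eq_comm] using this
  exact ⟨Equiv.ofFiberEquiv fun c => Fintype.equivOfCardEq (hcard c),
    Equiv.ofFiberEquiv_map _⟩

/-- A Hermitian matrix with prescribed ordered spectrum is diagonalized by a unitary whose columns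
are enumerated compatibly with the spectrum. -/
theorem IsOrderedSpectrum.exists_unitary {ι : Type*} [Fintype ι] [DecidableEq ι] {d : ℕ}
    {ρ : Matrix ι ι ℂ} {ev : Fin d → ℝ} (h : IsOrderedSpectrum ρ ev) (hρ : ρ.IsHermitian) :
    ∃ e : ι ≃ Fin d, ∃ U ∈ unitaryGroup ι ℂ,
      ρ = U * diagonal (fun k => (ev (e k) : ℂ)) * Uᴴ := by
  obtain ⟨U, hU, hd⟩ := hρ.exists_unitary_diagonal
  have hm := hρ.roots_charpoly_eq_eigenvalues.symm.trans h.2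
  obtain ⟨e, he⟩ := exists_equiv_of_map_univ_eq hm
  refine ⟨e, U, hU, ?_⟩
  have : (fun k => (ev (e k) : ℂ)) = fun k => (hρ.eigenvalues k : ℂ) := funext he
  rw [this]
  exact hd

theorem IsOrderedSpectrum.conj {ι : Type*} [Fintype ι] [DecidableEq ι] {d : ℕ}
    {ρ : Matrix ι ι ℂ} {ev : Fin d → ℝ} (h : IsOrderedSpectrum ρ ev) {U : Matrix ι ι ℂ}
    (hU : U ∈ unitaryGroup ι ℂ) : IsOrderedSpectrum (U * ρ * star U) ev := by
  refine ⟨h.1, ?_⟩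
  rw [Matrix.mul_assoc, charpoly_mul_comm, Matrix.mul_assoc, mem_unitaryGroup_iff'.1 hU,
    Matrix.mul_one]
  exact h.2

theorem conj_mem_densityMatrices {ι : Type*} [Fintype ι] [DecidableEq ι] {ρ : Matrix ι ι ℂ}
    (h : ρ ∈ densityMatrices ι) {U : Matrix ι ι ℂ} (hU : U ∈ unitaryGroup ι ℂ) :
    U * ρ * star U ∈ densityMatrices ι := by
  refine ⟨h.1.mul_mul_conjTranspose_same U, ?_⟩
  rw [Matrix.mul_assoc, trace_mul_comm, Matrix.mul_assoc, mem_unitaryGroup_iff'.1 hU,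
    Matrix.mul_one]
  exact h.2

/-- The quadratic form of a unitarily diagonalized matrix. -/
theorem re_form_diagonalization {ι : Type*} [Fintype ι] [DecidableEq ι] (U : Matrix ι ι ℂ)
    (w : ι → ℝ) (z : ι → ℂ) :
    (star z ⬝ᵥ (U * diagonal (fun k => (w k : ℂ)) * Uᴴ) *ᵥ z).re =
      ∑ k, w k * ‖star z ⬝ᵥ fun i => U i k‖ ^ 2 := by
  have h : star z ⬝ᵥ (U * diagonal (fun k => (w k : ℂ)) * Uᴴ) *ᵥ z =
      ∑ k, ((w k * ‖star z ⬝ᵥ fun i => U i k‖ ^ 2 : ℝ) : ℂ) := by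
    rw [← mulVec_mulVec, ← mulVec_mulVec, dotProduct_mulVec, dotProduct]
    refine Finset.sum_congr rfl fun k _ => ?_
    have e1 : (star z ᵥ* U) k = star z ⬝ᵥ fun i => U i k := rfl
    have e2 : (Uᴴ *ᵥ z) k = star (star z ⬝ᵥ fun i => U i k) := by
      rw [star_dotProduct, star_star]
      rfl
    rw [mulVec_diagonal, e1, e2]
    have := Complex.mul_conj' (star z ⬝ᵥ fun i => U i k)
    rw [RCLike.star_def, Complex.ofReal_mul, Complex.ofReal_pow, ← this]
    ring
  rw [h, Complex.re_sum]
  simp only [Complex.ofReal_re]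

/-- Since `⟨w̄_a, Mᵀ w̄_b⟩ = ⟨w_b, M w_a⟩`, writing the qubit factors of `ψ` as conjugates turns the
transposition into an exchange of the qubit indices. -/
theorem star_dotProduct_idTensor_transposeMap {n : ℕ} (X : BipartiteMatrix n 2)
    (g : Fin n → Fin 2 → ℂ) (W : Matrix (Fin 2) (Fin 2) ℂ) {ψ : Fin n × Fin 2 → ℂ}
    (hψ : ∀ i b, ψ (i, b) = ∑ a, g i a * star (W b a))
    {H : Fin 2 → Fin 2 → Fin n × Fin 2 → ℂ} (hH : ∀ a b i t, H a b (i, t) = g i a * W t b) :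
    star ψ ⬝ᵥ idTensor (transposeMap 2) X *ᵥ ψ = ∑ a, ∑ b, star (H a b) ⬝ᵥ X *ᵥ H b a := by
  have hX : ∀ i s j t, idTensor (transposeMap 2) X (i, s) (j, t) = X (i, t) (j, s) :=
    fun _ _ _ _ => rfl
  simp only [dotProduct, mulVec, Fintype.sum_prod_type, Pi.star_apply, hψ, hH, hX,
    Fin.sum_univ_two, star_mul', star_add, star_star, Finset.mul_sum, ← Finset.sum_add_distrib]
  refine Finset.sum_congr rfl fun i _ => Finset.sum_congr rfl fun j _ => ?_
  ring

/-- Schmidt decomposition of a vector in `ℂⁿ ⊗ ℂ²`. -/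
theorem exists_schmidt {n : ℕ} (ψ : Fin n × Fin 2 → ℂ) :
    ∃ (g : Fin n → Fin 2 → ℂ) (W : Matrix (Fin 2) (Fin 2) ℂ) (s : Fin 2 → ℝ),
      W ∈ unitaryGroup (Fin 2) ℂ ∧ (∀ a, 0 ≤ s a) ∧
      (∀ i b, ψ (i, b) = ∑ a, g i a * star (W b a)) ∧
      ∀ a b, ∑ i, star (g i a) * g i b = if a = b then ((s a ^ 2 : ℝ) : ℂ) else 0 := by
  obtain ⟨s, W, hW, hs, hd⟩ : ∃ s : Fin 2 → ℝ, ∃ W ∈ unitaryGroup (Fin 2) ℂ, (∀ a, 0 ≤ s a) ∧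
      (Matrix.of fun i b => ψ (i, b))ᴴ * (Matrix.of fun i b => ψ (i, b)) =
        W * diagonal (fun a => ((s a ^ 2 : ℝ) : ℂ)) * Wᴴ := by
    have hP := posSemidef_conjTranspose_mul_self (Matrix.of fun i b => ψ (i, b))
    obtain ⟨W, hW, hd⟩ := hP.isHermitian.exists_unitary_diagonal
    refine ⟨fun a => √(hP.isHermitian.eigenvalues a), W, hW, fun a => Real.sqrt_nonneg _, ?_⟩
    simp only [Real.sq_sqrt (hP.eigenvalues_nonneg _)]
    exact hd
  set Ψ : Matrix (Fin n) (Fin 2) ℂ := Matrix.of fun i b => ψ (i, b)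
  have hWW : Wᴴ * W = 1 := mem_unitaryGroup_iff'.1 hW
  have hWW' : W * Wᴴ = 1 := mem_unitaryGroup_iff.1 hW
  refine ⟨Ψ * W, W, s, hW, hs, fun i b => ?_, fun a b => ?_⟩
  · have : Ψ = (Ψ * W) * Wᴴ := by rw [Matrix.mul_assoc, hWW', Matrix.mul_one]
    exact congrFun (congrFun this i) b
  · have : (Ψ * W)ᴴ * (Ψ * W) = diagonal (fun a => ((s a ^ 2 : ℝ) : ℂ)) := by
      calc (Ψ * W)ᴴ * (Ψ * W) = Wᴴ * (Ψᴴ * Ψ) * W := by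
            rw [conjTranspose_mul]; simp only [Matrix.mul_assoc]
        _ = (Wᴴ * W) * diagonal (fun a => ((s a ^ 2 : ℝ) : ℂ)) * (Wᴴ * W) := by
            rw [hd]; simp only [Matrix.mul_assoc]
        _ = _ := by rw [hWW]; simp
    have h2 := congrFun (congrFun this a) b
    rw [diagonal_apply] at h2
    exact h2

theorem isHermitian_idTensor_transposeMap {n k : ℕ} {X : BipartiteMatrix n k}
    (hX : X.IsHermitian) : (idTensor (transposeMap k) X).IsHermitian := by
  ext ⟨i, s⟩ ⟨j, t⟩
  exact hX.apply (i, t) (j, s)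

/-- A state whose spectrum satisfies the eigenvalue inequality has positive partial transpose. -/
theorem posSemidef_transpose_of_spectrum {n : ℕ} (hn : 2 ≤ n) {ρ : BipartiteMatrix n 2}
    (hρ : ρ.PosSemidef) {ev : Fin (2 * n) → ℝ} (hev : IsOrderedSpectrum ρ ev)
    {i₀ i₁ i₂ i₃ : Fin (2 * n)} (hi₀ : i₀.val = 0) (hi₁ : i₁.val = 2 * n - 2)
    (hi₂ : i₂.val = 2 * n - 1) (hi₃ : i₃.val = 2 * n - 3)
    (hl : ev i₀ ≤ ev i₁ + 2 * √(ev i₃ * ev i₂)) :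
    (idTensor (transposeMap 2) ρ).PosSemidef := by
  obtain ⟨e, U, hU, hd⟩ := hev.exists_unitary hρ.isHermitian
  have hUU : Uᴴ * U = 1 := mem_unitaryGroup_iff'.1 hU
  have hUU' : U * Uᴴ = 1 := mem_unitaryGroup_iff.1 hU
  have hne : i₁ ≠ i₂ := by
    rw [Ne, Fin.ext_iff]; omega
  set k₁ := e.symm i₁
  set k₂ := e.symm i₂
  have hk : k₁ ≠ k₂ := fun h => hne (e.symm.injective h)
  let E := EuclideanSpace ℂ (Fin n × Fin 2)
  have hform : ∀ z : E, (inner ℂ z (toEuclideanLin ρ z)) = star z.ofLp ⬝ᵥ ρ *ᵥ z.ofLp := by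
    intro z
    rw [EuclideanSpace.inner_eq_star_dotProduct, dotProduct_comm]
    rfl
  have hcol : ∀ k l, star (fun i => U i k) ⬝ᵥ (fun i => U i l) = if k = l then 1 else 0 := by
    intro k l
    rw [← one_apply, ← hUU]
    rfl
  let u : Fin n × Fin 2 → E := fun k => WithLp.toLp 2 fun i => U i k
  have hu : Orthonormal ℂ u := by
    rw [orthonormal_iff_ite]
    intro k l
    rw [EuclideanSpace.inner_eq_star_dotProduct, dotProduct_comm]
    exact hcol k l
  have hin : ∀ (z : E) k, inner ℂ z (u k) = star z.ofLp ⬝ᵥ fun i => U i k := by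
    intro z k
    rw [EuclideanSpace.inner_eq_star_dotProduct, dotProduct_comm]
  have hQ : ∀ z : E, RCLike.re (inner ℂ z (toEuclideanLin ρ z)) =
      ∑ k, ev (e k) * ‖inner ℂ z (u k)‖ ^ 2 := by
    intro z
    simp only [hin]
    rw [hform, ← re_form_diagonalization, ← hd]
    rfl
  have hN : ∀ z : E, ‖z‖ ^ 2 = ∑ k, ‖inner ℂ z (u k)‖ ^ 2 := by
    intro z
    have h1 := re_form_diagonalization U (fun _ => (1 : ℝ)) z.ofLp
    simp only [Complex.ofReal_one, diagonal_one, Matrix.mul_one, hUU', one_mulVec, one_mul,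
      ← hin] at h1
    rw [← h1, ← inner_self_eq_norm_sq (𝕜 := ℂ), EuclideanSpace.inner_eq_star_dotProduct,
      dotProduct_comm]
    rfl
  have hev0 : ∀ i, 0 ≤ ev i := by
    intro i
    have h1 := hρ.re_dotProduct_nonneg (fun j => U j (e.symm i))
    have h2 := hQ (u (e.symm i))
    have h3 : RCLike.re (inner ℂ (u (e.symm i)) (toEuclideanLin ρ (u (e.symm i)))) = ev i := by
      rw [h2, Finset.sum_eq_single (e.symm i)]
      · rw [orthonormal_iff_ite.1 hu, if_pos rfl, Equiv.apply_symm_apply]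
        simp
      · intro k _ hki
        rw [orthonormal_iff_ite.1 hu, if_neg (Ne.symm hki)]
        simp
      · simp
    rw [hform] at h3
    rw [← h3]
    exact h1
  have hrq : ev i₂ ≤ ev i₁ := hev.1 (by rw [Fin.le_def]; omega)
  have hqp : ev i₁ ≤ ev i₃ := hev.1 (by rw [Fin.le_def]; omega)
  have hlow : ∀ z : E, ev i₃ * ‖z‖ ^ 2 - (ev i₃ - ev i₁) * ‖inner ℂ z (u k₁)‖ ^ 2 -
      (ev i₃ - ev i₂) * ‖inner ℂ z (u k₂)‖ ^ 2 ≤ RCLike.re (inner ℂ z (toEuclideanLin ρ z)) := by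
    intro z
    rw [hQ, hN, Finset.mul_sum]
    have h1 : ∀ k₀ : Fin n × Fin 2, ‖inner ℂ z (u k₀)‖ ^ 2 =
        ∑ k, if k₀ = k then ‖inner ℂ z (u k)‖ ^ 2 else 0 := fun k₀ => by
      rw [Finset.sum_ite_eq]; simp
    rw [h1 k₁, h1 k₂, Finset.mul_sum, Finset.mul_sum, ← Finset.sum_sub_distrib,
      ← Finset.sum_sub_distrib]
    refine Finset.sum_le_sum fun k _ => ?_
    have hsq := sq_nonneg ‖inner ℂ z (u k)‖
    by_cases hk1 : k₁ = k
    · rw [if_pos hk1, if_neg (fun h => hk (hk1.trans h.symm)), ← hk1, Equiv.apply_symm_apply]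
      linarith
    by_cases hk2 : k₂ = k
    · rw [if_neg hk1, if_pos hk2, ← hk2, Equiv.apply_symm_apply]
      linarith
    · rw [if_neg hk1, if_neg hk2]
      -- Away from the last two positions the index is at most `2n - 3`.
      have h2 : ev i₃ ≤ ev (e k) := by
        refine hev.1 ?_
        have n1 : e k ≠ i₁ := fun h => hk1 (by rw [← e.symm_apply_apply k, h])
        have n2 : e k ≠ i₂ := fun h => hk2 (by rw [← e.symm_apply_apply k, h])
        rw [Ne, Fin.ext_iff] at n1 n2
        rw [Fin.le_def]
        have := (e k).2
        omega
      have := mul_le_mul_of_nonneg_right h2 hsq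
      linarith
  have hup : ∀ z : E, RCLike.re (inner ℂ z (toEuclideanLin ρ z)) ≤ ev i₀ * ‖z‖ ^ 2 := by
    intro z
    rw [hQ, hN, Finset.mul_sum]
    refine Finset.sum_le_sum fun k _ => mul_le_mul_of_nonneg_right (hev.1 ?_) (sq_nonneg _)
    rw [Fin.le_def, hi₀]
    exact Nat.zero_le _
  have hT0 : ∀ z : E, 0 ≤ RCLike.re (inner ℂ z (toEuclideanLin ρ z)) := by
    intro z
    rw [hQ]
    exact Finset.sum_nonneg fun k _ => mul_nonneg (hev0 _) (sq_nonneg _)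
  have hsymm : (toEuclideanLin ρ).IsSymmetric := isSymmetric_toEuclideanLin_iff.2 hρ.isHermitian
  have hPT := isHermitian_idTensor_transposeMap hρ.isHermitian
  refine PosSemidef.of_dotProduct_mulVec_nonneg hPT fun ψ => ?_
  rw [Complex.nonneg_iff]
  refine ⟨?_, (hPT.im_star_dotProduct_mulVec_self ψ).symm⟩
  -- The products of Schmidt vectors are orthogonal with `‖H a b‖ = s a`, and the two cross terms of
  -- the form are complex conjugates.
  obtain ⟨g, W, s, hW, hs, hψ, hg⟩ := exists_schmidt ψ
  have hWW : Wᴴ * W = 1 := mem_unitaryGroup_iff'.1 hW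
  let H : Fin 2 → Fin 2 → Fin n × Fin 2 → ℂ := fun a b x => g x.1 a * W x.2 b
  rw [star_dotProduct_idTensor_transposeMap ρ g W hψ (H := H) (fun _ _ _ _ => rfl)]
  have hH : ∀ a b c d, inner ℂ (WithLp.toLp 2 (H a b) : E) (WithLp.toLp 2 (H c d) : E) =
      if a = c ∧ b = d then ((s a ^ 2 : ℝ) : ℂ) else 0 := by
    intro a b c d
    have h1 : inner ℂ (WithLp.toLp 2 (H a b) : E) (WithLp.toLp 2 (H c d) : E) =
        (∑ i, star (g i a) * g i c) * (Wᴴ * W) b d := by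
      rw [EuclideanSpace.inner_eq_star_dotProduct, dotProduct_comm]
      simp only [dotProduct, mul_apply, Finset.sum_mul_sum, Fintype.sum_prod_type, H,
        Pi.star_apply, star_mul', conjTranspose_apply]
      exact Finset.sum_congr rfl fun i _ => Finset.sum_congr rfl fun j _ => by ring
    rw [h1, hg, hWW, one_apply]
    split_ifs <;> simp_all
  have key := two_pair_form_nonneg hsymm (hu.1 k₁) (hu.1 k₂)
    ((orthonormal_iff_ite.1 hu k₁ k₂).trans (if_neg hk)) (hev0 i₂) hrq hqp hlow hup hl hT0
    (h := fun a b => WithLp.toLp 2 (H a b)) hs hH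
  have hre : ∀ a b c d, RCLike.re (inner ℂ (WithLp.toLp 2 (H a b) : E)
      (toEuclideanLin ρ (WithLp.toLp 2 (H c d)))) = (star (H a b) ⬝ᵥ ρ *ᵥ H c d).re := by
    intro a b c d
    rw [EuclideanSpace.inner_eq_star_dotProduct, dotProduct_comm]
    rfl
  have hsw : (star (H 1 0) ⬝ᵥ ρ *ᵥ H 0 1).re = (star (H 0 1) ⬝ᵥ ρ *ᵥ H 1 0).re := by
    rw [← hre, ← hre, ← hsymm, ← inner_conj_symm, RCLike.conj_re]
  simp only [hre] at key
  simp only [Fin.sum_univ_two, Complex.add_re]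
  linarith

end QuantumBipartite

/-! ### Necessity of the eigenvalue inequality, and the reduction map on a qubit. -/

namespace QuantumBipartite

open Matrix

theorem exists_unitary_columns {ι κ : Type*} [Fintype ι] [DecidableEq ι] [DecidableEq κ]
    {k : κ → ι} (hk : Function.Injective k) (w : κ → ι → ℂ)
    (hw : ∀ a b, star (w a) ⬝ᵥ w b = if a = b then 1 else 0) :
    ∃ W ∈ unitaryGroup ι ℂ, ∀ a, W *ᵥ Pi.single (k a) 1 = w a := by
  obtain ⟨W, hW, h⟩ := exists_unitary_extend_columns (Set.range k) (Function.extend k w 0) (by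
    rintro _ ⟨a, rfl⟩ _ ⟨b, rfl⟩
    rw [hk.extend_apply, hk.extend_apply, hw]
    simp [hk.eq_iff])
  refine ⟨W, hW, fun a => ?_⟩
  ext i
  rw [mulVec_single_one, col_apply, h _ ⟨a, rfl⟩, hk.extend_apply]

/-- The smallest eigenvalues go on the diagonal of a 2×2 minor of the partial transpose, while the
symmetric and antisymmetric combinations carry `λ_{2n-1}` and `λ_1`, making the off-diagonal entry
half their difference. -/
theorem spectrum_le_of_mem_APPT {n : ℕ} (hn : 2 ≤ n) {ρ : BipartiteMatrix n 2}
    {ev : Fin (2 * n) → ℝ} (hev : IsOrderedSpectrum ρ ev) (h : ρ ∈ APPT n 2)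
    {i₀ i₁ i₂ i₃ : Fin (2 * n)} (hi₀ : i₀.val = 0) (hi₁ : i₁.val = 2 * n - 2)
    (hi₂ : i₂.val = 2 * n - 1) (hi₃ : i₃.val = 2 * n - 3) :
    ev i₀ ≤ ev i₁ + 2 * √(ev i₃ * ev i₂) := by
  obtain ⟨e, U, hU, hd⟩ := hev.exists_unitary h.1.1.isHermitian
  have hUU : Uᴴ * U = 1 := mem_unitaryGroup_iff'.1 hU
  let x₀ : Fin n := ⟨0, by omega⟩
  let x₁ : Fin n := ⟨1, by omega⟩
  have hx : x₀ ≠ x₁ := by simp [x₀, x₁]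
  let i : Fin 4 → Fin (2 * n) := ![i₂, i₃, i₁, i₀]
  have hi : Function.Injective i := by
    intro a b hab
    rw [Fin.ext_iff] at hab
    fin_cases a <;> fin_cases b <;> simp [i] at hab ⊢ <;> omega
  set c : ℂ := Complex.ofReal (√2)⁻¹ with hc
  have hcc : starRingEnd ℂ c = c := Complex.conj_ofReal _
  have hc2 : c * c = 1 / 2 := by
    rw [hc, ← Complex.ofReal_mul, ← mul_inv, Real.mul_self_sqrt (by norm_num)]
    norm_num
  have hc0 : c ≠ 0 := by
    intro h0; rw [h0] at hc2; norm_num at hc2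
  let s : Fin n × Fin 2 → Fin n × Fin 2 → ℂ := fun p => Pi.single p 1
  let w : Fin 4 → Fin n × Fin 2 → ℂ := ![s (x₀, 0), s (x₁, 1), c • (s (x₀, 1) + s (x₁, 0)),
    c • (s (x₀, 1) - s (x₁, 0))]
  obtain ⟨W, hW, hWw⟩ := exists_unitary_columns (k := fun a => e.symm (i a))
    (e.symm.injective.comp hi) w (by
      intro a b
      fin_cases a <;> fin_cases b <;>
        simp [w, s, hx, hx.symm, hcc] <;> linear_combination 2 * hc2)
  have hWW : Wᴴ * W = 1 := mem_unitaryGroup_iff'.1 hW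
  have hPPT := h.2 (W * Uᴴ) (mul_mem hW (Unitary.star_mem hU))
  set X : BipartiteMatrix n 2 := W * Uᴴ * ρ * star (W * Uᴴ) with hX
  have hXd : X = W * diagonal (fun k => (ev (e k) : ℂ)) * Wᴴ := by
    calc X = W * ((Uᴴ * U) * diagonal (fun k => (ev (e k) : ℂ)) * (Uᴴ * U)) * Wᴴ := by
          rw [hX, hd, star_eq_conjTranspose, conjTranspose_mul, conjTranspose_conjTranspose]
          simp only [Matrix.mul_assoc]
      _ = _ := by rw [hUU]; simp
  have hXw : ∀ a, X *ᵥ w a = (ev (i a) : ℂ) • w a := by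
    intro a
    rw [hXd, ← hWw, mulVec_mulVec, Matrix.mul_assoc, hWW, Matrix.mul_one, ← mulVec_mulVec,
      diagonal_mulVec_single, mul_one, Equiv.apply_symm_apply, ← mulVec_smul]
    congr 1
    rw [← Pi.single_smul, smul_eq_mul, mul_one]
  have hXs : ∀ p q, X p q = (X *ᵥ s q) p := fun p q => by
    rw [mulVec_single_one, col_apply]
  have h00 : X (x₀, 0) (x₀, 0) = ev (i 0) := by
    rw [hXs, show s (x₀, 0) = w 0 from rfl, hXw]
    simp [w, s]
  have h11 : X (x₁, 1) (x₁, 1) = ev (i 1) := by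
    rw [hXs, show s (x₁, 1) = w 1 from rfl, hXw]
    simp [w, s]
  have hp : X *ᵥ s (x₀, 1) + X *ᵥ s (x₁, 0) = (ev (i 2) : ℂ) • (s (x₀, 1) + s (x₁, 0)) := by
    have := hXw 2
    rw [show w 2 = c • (s (x₀, 1) + s (x₁, 0)) from rfl, mulVec_smul, smul_comm, mulVec_add] at this
    exact smul_right_injective _ hc0 this
  have hm : X *ᵥ s (x₀, 1) - X *ᵥ s (x₁, 0) = (ev (i 3) : ℂ) • (s (x₀, 1) - s (x₁, 0)) := by
    have := hXw 3
    rw [show w 3 = c • (s (x₀, 1) - s (x₁, 0)) from rfl, mulVec_smul, smul_comm, mulVec_sub] at this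
    exact smul_right_injective _ hc0 this
  have h01 : X (x₀, 1) (x₁, 0) = (ev (i 2) - ev (i 3)) / 2 := by
    have e1 := congrFun hp (x₀, 1)
    have e2 := congrFun hm (x₀, 1)
    rw [hXs]
    simp [s, hx] at e1 e2 ⊢
    linear_combination (e1 - e2) / 2
  have h10 : X (x₁, 0) (x₀, 1) = (ev (i 2) - ev (i 3)) / 2 := by
    have e1 := congrFun hp (x₁, 0)
    have e2 := congrFun hm (x₁, 0)
    rw [hXs]
    simp [s, hx.symm] at e1 e2 ⊢
    linear_combination (e1 + e2) / 2
  -- Partial transposition moves the entry between `(x₀, 1)` and `(x₁, 0)` to the pair `(x₀, 0)`,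
  -- `(x₁, 1)`.
  have hdet := (hPPT.2.submatrix ![(x₀, (0 : Fin 2)), (x₁, 1)]).det_nonneg
  rw [det_fin_two] at hdet
  have hT : ∀ i s j t, idTensor (transposeMap 2) X (i, s) (j, t) = X (i, t) (j, s) :=
    fun _ _ _ _ => rfl
  simp only [submatrix_apply, cons_val_zero, cons_val_one, hT, h00, h11, h01, h10] at hdet
  have hreal : 0 ≤ ev (i 0) * ev (i 1) - (ev (i 2) - ev (i 3)) / 2 * ((ev (i 2) - ev (i 3)) / 2) := by
    exact_mod_cast hdet
  have hsq : ((ev (i 3) - ev (i 2)) / 2) ^ 2 ≤ ev (i 1) * ev (i 0) := by nlinarith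
  have := Real.le_sqrt_of_sq_le hsq
  change ev (i 3) ≤ ev (i 2) + 2 * √(ev (i 1) * ev (i 0))
  linarith

/-- For 2×2 matrices `Tr(X) - X` is the adjugate of `X`, which equals `J Xᵀ J*` with `J` the
rotation by a right angle. -/
theorem idTensor_reductionMap_eq {n : ℕ} (X : BipartiteMatrix n 2) :
    idTensor (reductionMap 2) X =
      ((1 : Matrix (Fin n) (Fin n) ℂ) ⊗ₖ !![0, 1; -1, 0]) * idTensor (transposeMap 2) X *
        ((1 : Matrix (Fin n) (Fin n) ℂ) ⊗ₖ !![0, 1; -1, 0])ᴴ := by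
  ext ⟨i, s⟩ ⟨j, t⟩
  have hT : ∀ i s j t, idTensor (transposeMap 2) X (i, s) (j, t) = X (i, t) (j, s) :=
    fun _ _ _ _ => rfl
  have hR : idTensor (reductionMap 2) X (i, s) (j, t) =
      (X (i, 0) (j, 0) + X (i, 1) (j, 1)) * (1 : Matrix (Fin 2) (Fin 2) ℂ) s t -
        X (i, s) (j, t) := by
    rw [← trace_fin_two_of (X (i, 0) (j, 0)) (X (i, 0) (j, 1)) (X (i, 1) (j, 0))]
    change (trace (Matrix.of fun a b => X (i, a) (j, b)) • (1 : Matrix (Fin 2) (Fin 2) ℂ) -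
      Matrix.of fun a b => X (i, a) (j, b)) s t = _
    rw [Matrix.sub_apply, Matrix.smul_apply, smul_eq_mul, trace_fin_two, trace_fin_two]
    rfl
  rw [hR]
  simp only [mul_apply, Fintype.sum_prod_type, kroneckerMap_apply, conjTranspose_apply, hT,
    Fin.sum_univ_two, one_apply, ite_mul, one_mul, zero_mul, Finset.sum_add_distrib]
  fin_cases s <;> fin_cases t <;> simp [Finset.sum_ite_eq, apply_ite]

theorem posSemidef_reduction_iff {n : ℕ} (X : BipartiteMatrix n 2) :
    (idTensor (reductionMap 2) X).PosSemidef ↔ (idTensor (transposeMap 2) X).PosSemidef := by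
  rw [idTensor_reductionMap_eq]
  refine IsUnit.posSemidef_star_right_conjugate_iff (IsUnit.of_mul_eq_one
    ((1 : Matrix (Fin n) (Fin n) ℂ) ⊗ₖ !![0, -1; 1, 0]) ?_)
  rw [← mul_kronecker_mul, Matrix.one_mul, ← one_kronecker_one]
  congr 1
  ext i j
  fin_cases i <;> fin_cases j <;> simp

theorem RED_eq_PPT (n : ℕ) : RED n 2 = PPT n 2 :=
  Set.ext fun X => and_congr_right fun _ => posSemidef_reduction_iff X

end QuantumBipartite

/-! ### Moving pairs of vectors by unitaries. -/

namespace Matrix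

variable {ι : Type*} [Fintype ι] [DecidableEq ι]

/-- A complex Householder reflection: vectors of equal length are exchanged by a unitary that
fixes the orthogonal complement of their difference. -/
theorem exists_unitary_reflection {p q : ι → ℂ} (h : star p ⬝ᵥ p = star q ⬝ᵥ q) :
    ∃ Z ∈ unitaryGroup ι ℂ, Z *ᵥ p = q ∧ ∀ v, star (p - q) ⬝ᵥ v = 0 → Z *ᵥ v = v := by
  by_cases hpq : p = q
  · exact ⟨1, one_mem _, by rw [one_mulVec, hpq], fun v _ => one_mulVec v⟩
  set d := p - q with hd
  set α := star d ⬝ᵥ p with hα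
  -- Equality of lengths gives `d*d = α + ᾱ`, exactly the condition for `1 - α⁻¹ d d*` to be
  -- unitary.
  have hN : star d ⬝ᵥ d = α + star α := by
    have h1 : star α = star p ⬝ᵥ d := by
      rw [hα, ← star_dotProduct_star, star_star, dotProduct_comm]
    rw [h1, hα, hd]
    simp only [star_sub, sub_dotProduct, dotProduct_sub]
    linear_combination -h
  have hd0 : star d ⬝ᵥ d ≠ 0 := by
    rw [Ne, dotProduct_star_self_eq_zero]
    exact sub_ne_zero.2 hpq
  have hα0 : α ≠ 0 := by
    intro h0
    rw [h0, star_zero, add_zero] at hN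
    exact hd0 hN
  have hα0' : star α ≠ 0 := star_ne_zero.2 hα0
  have hmul : ∀ v, vecMulVec d (star d) *ᵥ v = (star d ⬝ᵥ v) • d := fun v => by
    rw [vecMulVec_mulVec, op_smul_eq_smul]
  refine ⟨1 - α⁻¹ • vecMulVec d (star d), ?_, ?_, fun v hv => ?_⟩
  · rw [mem_unitaryGroup_iff, star_eq_conjTranspose, conjTranspose_sub, conjTranspose_one,
      conjTranspose_smul, conjTranspose_vecMulVec, star_star]
    have h2 : vecMulVec d (star d) * vecMulVec d (star d) =
        (star d ⬝ᵥ d) • vecMulVec d (star d) := by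
      rw [vecMulVec_mul_vecMulVec]
      ext i j
      simp [vecMulVec_apply]
      ring
    rw [sub_mul, mul_sub, mul_sub, Matrix.one_mul, Matrix.mul_one, Matrix.one_mul,
      smul_mul_smul_comm, h2, smul_smul, sub_sub, ← add_sub_assoc, ← add_smul, ← sub_smul,
      sub_eq_self, hN]
    convert zero_smul ℂ _ using 2
    rw [star_inv₀]
    field_simp
    ring
  · rw [sub_mulVec, one_mulVec, smul_mulVec, hmul, ← hα, smul_smul, inv_mul_cancel₀ hα0, one_smul,
      hd, sub_sub_cancel]
  · rw [sub_mulVec, one_mulVec, smul_mulVec, hmul, hv, zero_smul, smul_zero, sub_zero]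

/-- Pairs of unit vectors with the same inner product are unitarily equivalent. -/
theorem exists_unitary_map_pair {x u v y : ι → ℂ} (hx : star x ⬝ᵥ x = 1) (hu : star u ⬝ᵥ u = 1)
    (hv : star v ⬝ᵥ v = 1) (hy : star y ⬝ᵥ y = 1) (h : star x ⬝ᵥ u = star v ⬝ᵥ y) :
    ∃ Z ∈ unitaryGroup ι ℂ, Z *ᵥ x = v ∧ Z *ᵥ u = y := by
  obtain ⟨Z₁, hZ₁, h₁, -⟩ := exists_unitary_reflection (hx.trans hv.symm)
  have hiso : ∀ a b, star (Z₁ *ᵥ a) ⬝ᵥ (Z₁ *ᵥ b) = star a ⬝ᵥ b := by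
    intro a b
    rw [star_mulVec, dotProduct_mulVec, vecMul_vecMul, ← star_eq_conjTranspose,
      mem_unitaryGroup_iff'.1 hZ₁, vecMul_one]
  -- The second reflection takes `Z₁ u` to `y` and keeps `v`, because equal inner products make `v`
  -- orthogonal to `Z₁ u - y`.
  obtain ⟨Z₂, hZ₂, h₂, hfix⟩ := exists_unitary_reflection (((hiso u u).trans hu).trans hy.symm)
  refine ⟨Z₂ * Z₁, mul_mem hZ₂ hZ₁, ?_, by rw [← mulVec_mulVec, h₂]⟩
  rw [← mulVec_mulVec, h₁]
  refine hfix v ?_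
  have h3 : star v ⬝ᵥ (Z₁ *ᵥ u - y) = 0 := by
    rw [dotProduct_sub, ← h, ← h₁, hiso, sub_self]
  rw [star_dotProduct, h3, star_zero]

end Matrix

/-! ### Control of the off-diagonal block for absolutely PPT states. -/

namespace QuantumBipartite

open Matrix

theorem conj_mem_absolutely {n k : ℕ} {S : Set (BipartiteMatrix n k)} {ρ : BipartiteMatrix n k}
    (h : ρ ∈ absolutely S) {V : BipartiteMatrix n k} (hV : V ∈ unitaryGroup (Fin n × Fin k) ℂ) :
    V * ρ * star V ∈ absolutely S := by
  refine ⟨conj_mem_densityMatrices h.1 hV, fun U hU => ?_⟩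
  have := h.2 (U * V) (mul_mem hU hV)
  rwa [star_mul, ← Matrix.mul_assoc, Matrix.mul_assoc U, Matrix.mul_assoc U] at this

/-- Block-diagonal matrices controlled by the qubit. -/
def qubitDiagonal {n : ℕ} (D : Fin 2 → Matrix (Fin n) (Fin n) ℂ) : BipartiteMatrix n 2 :=
  Matrix.of fun p q => if p.2 = q.2 then D p.2 p.1 q.1 else 0

theorem qubitBlock_conj_qubitDiagonal {n : ℕ} (D : Fin 2 → Matrix (Fin n) (Fin n) ℂ)
    (X : BipartiteMatrix n 2) (s t : Fin 2) :
    qubitBlock (qubitDiagonal D * X * star (qubitDiagonal D)) s t =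
      D s * qubitBlock X s t * (D t)ᴴ := by
  ext i j
  simp only [qubitBlock, qubitDiagonal, mul_apply, of_apply, star_apply, conjTranspose_apply,
    Fintype.sum_prod_type, Fin.sum_univ_two]
  fin_cases s <;> fin_cases t <;> simp

theorem qubitDiagonal_mem_unitaryGroup {n : ℕ} {D : Fin 2 → Matrix (Fin n) (Fin n) ℂ}
    (hD : ∀ s, D s ∈ unitaryGroup (Fin n) ℂ) :
    qubitDiagonal D ∈ unitaryGroup (Fin n × Fin 2) ℂ := by
  rw [mem_unitaryGroup_iff]
  have h1 := fun s t => qubitBlock_conj_qubitDiagonal D 1 s t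
  have h2 : ∀ s t, qubitBlock (1 : BipartiteMatrix n 2) s t = if s = t then 1 else 0 := by
    intro s t
    ext i j
    by_cases hst : s = t
    · simp [qubitBlock, one_apply, hst]
    · simp [qubitBlock, hst]
  ext ⟨i, s⟩ ⟨j, t⟩
  have h3 := congrFun (congrFun (h1 s t) i) j
  rw [Matrix.mul_one, h2] at h3
  change qubitBlock (qubitDiagonal D * star (qubitDiagonal D)) s t i j = qubitBlock 1 s t i j
  change qubitBlock (qubitDiagonal D * star (qubitDiagonal D)) s t i j = _ at h3
  rw [h3, h2]
  split_ifs with hst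
  · subst hst
    rw [Matrix.mul_one, ← star_eq_conjTranspose, mem_unitaryGroup_iff.1 (hD s)]
  · simp

theorem form_eq_blocks {n : ℕ} (X : BipartiteMatrix n 2) (a b : Fin n → ℂ) :
    star (fun p : Fin n × Fin 2 => ![a p.1, b p.1] p.2) ⬝ᵥ X *ᵥ (fun p => ![a p.1, b p.1] p.2) =
      star a ⬝ᵥ qubitBlock X 0 0 *ᵥ a + star a ⬝ᵥ qubitBlock X 0 1 *ᵥ b +
        (star b ⬝ᵥ qubitBlock X 1 0 *ᵥ a + star b ⬝ᵥ qubitBlock X 1 1 *ᵥ b) := by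
  simp only [dotProduct, mulVec, Fintype.sum_prod_type, Fin.sum_univ_two, Pi.star_apply, qubitBlock,
    of_apply, cons_val_zero, cons_val_one, Finset.mul_sum, Finset.sum_add_distrib, mul_add]
  ring

theorem qubitBlock_transpose {n : ℕ} (X : BipartiteMatrix n 2) (s t : Fin 2) :
    qubitBlock (idTensor (transposeMap 2) X) s t = qubitBlock X t s := rfl

theorem qubitBlock_conjTranspose {n : ℕ} {X : BipartiteMatrix n 2} (hX : X.IsHermitian)
    (s t : Fin 2) : (qubitBlock X s t)ᴴ = qubitBlock X t s := by
  ext i j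
  exact hX.apply (i, t) (j, s)

theorem exists_phase {a b : ℂ} (h : ‖a‖ = ‖b‖) : ∃ ζ : ℂ, star ζ * ζ = 1 ∧ a = ζ * b := by
  by_cases hb : b = 0
  · refine ⟨1, by simp, ?_⟩
    rw [hb, norm_zero, norm_eq_zero] at h
    rw [h, hb, mul_zero]
  · refine ⟨a / b, ?_, by field_simp⟩
    rw [RCLike.star_def, Complex.conj_mul', norm_div, h, div_self (norm_ne_zero_iff.2 hb)]
    simp

/-- For an absolutely PPT state the off-diagonal block is controlled by the diagonal blocks along
vectors with matching overlaps. -/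
theorem sq_re_offDiag_le_of_mem_APPT {n : ℕ} {ρ : BipartiteMatrix n 2} (h : ρ ∈ APPT n 2)
    {x y u v : Fin n → ℂ} (hx : star x ⬝ᵥ x = 1) (hy : star y ⬝ᵥ y = 1) (hu : star u ⬝ᵥ u = 1)
    (hv : star v ⬝ᵥ v = 1) (hm : ‖star x ⬝ᵥ u‖ = ‖star y ⬝ᵥ v‖) :
    (star x ⬝ᵥ qubitBlock ρ 0 1 *ᵥ y).re ^ 2 ≤
      (star u ⬝ᵥ qubitBlock ρ 0 0 *ᵥ u).re * (star v ⬝ᵥ qubitBlock ρ 1 1 *ᵥ v).re := by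
  have hm' : ‖star x ⬝ᵥ u‖ = ‖star v ⬝ᵥ y‖ := by
    rw [hm, ← norm_star (star v ⬝ᵥ y), ← star_dotProduct_star, star_star, dotProduct_comm]
  obtain ⟨ζ, hζ, hζm⟩ := exists_phase hm'
  have hζ' : ζ * star ζ = 1 := by rw [mul_comm, hζ]
  -- Multiplying `v` by a phase upgrades equality of moduli to `⟨x,u⟩ = ⟨v',y⟩`, so a unitary `Z`
  -- with `Zx = v'` and `Zu = y` exists.
  obtain ⟨v', hv'⟩ : ∃ v', v' = star ζ • v := ⟨_, rfl⟩
  obtain ⟨Z, hZ, hZx, hZu⟩ := exists_unitary_map_pair (v := v') hx hu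
    (by rw [hv', star_smul, star_star, smul_dotProduct, dotProduct_smul, hv, smul_smul, hζ',
      one_smul])
    hy (by rw [hv', star_smul, star_star, smul_dotProduct, smul_eq_mul, hζm])
  have hZZ : Zᴴ * Z = 1 := mem_unitaryGroup_iff'.1 hZ
  have hP := (h.2 (qubitDiagonal ![Z, 1]) (qubitDiagonal_mem_unitaryGroup (by
    intro s; fin_cases s
    · exact hZ
    · exact one_mem _))).2
  have hherm := h.1.1.isHermitian
  set α := (star u ⬝ᵥ qubitBlock ρ 0 0 *ᵥ u).re
  set γ := (star v ⬝ᵥ qubitBlock ρ 1 1 *ᵥ v).re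
  set β := (star x ⬝ᵥ qubitBlock ρ 0 1 *ᵥ y).re
  have hZv : Zᴴ *ᵥ v' = x := by
    rw [← hZx, mulVec_mulVec, hZZ, one_mulVec]
  -- After conjugation by `Z` on level `0` of the qubit, the partial transpose is tested on `(s y, t
  -- v')`: `Z` carries `u` to `y` in the block `A`, and `Z*` carries `v'` back to `x` in the block
  -- `B`.
  have key : ∀ s t : ℝ, 0 ≤ s ^ 2 * α + t ^ 2 * γ + 2 * (s * t) * β := by
    intro s t
    have h1 := hP.re_dotProduct_nonneg (fun p : Fin n × Fin 2 =>
      ![((s : ℂ) • y) p.1, ((t : ℂ) • v') p.1] p.2)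
    rw [form_eq_blocks] at h1
    simp only [qubitBlock_transpose, qubitBlock_conj_qubitDiagonal, cons_val_zero, cons_val_one,
      conjTranspose_one, Matrix.mul_one, Matrix.one_mul] at h1
    have e00 : star y ⬝ᵥ (Z * qubitBlock ρ 0 0 * Zᴴ) *ᵥ y = star u ⬝ᵥ qubitBlock ρ 0 0 *ᵥ u := by
      rw [← hZu, mulVec_mulVec, Matrix.mul_assoc, hZZ, Matrix.mul_one, star_mulVec,
        dotProduct_mulVec, vecMul_vecMul, ← Matrix.mul_assoc, hZZ, Matrix.one_mul,
        ← dotProduct_mulVec]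
    have e10 : star v' ⬝ᵥ (Z * qubitBlock ρ 0 1) *ᵥ y =
        star x ⬝ᵥ qubitBlock ρ 0 1 *ᵥ y := by
      rw [← mulVec_mulVec, dotProduct_mulVec, ← conjTranspose_conjTranspose Z, ← star_mulVec, hZv]
    have e01 : star y ⬝ᵥ (qubitBlock ρ 1 0 * Zᴴ) *ᵥ v' =
        star (star x ⬝ᵥ qubitBlock ρ 0 1 *ᵥ y) := by
      rw [← mulVec_mulVec, hZv, ← qubitBlock_conjTranspose hherm 0 1, dotProduct_mulVec,
        ← star_mulVec, star_dotProduct]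
    have e11 : star v' ⬝ᵥ qubitBlock ρ 1 1 *ᵥ v' =
        star v ⬝ᵥ qubitBlock ρ 1 1 *ᵥ v := by
      rw [hv', star_smul, star_star, smul_dotProduct, mulVec_smul, dotProduct_smul, smul_smul, hζ',
        one_smul]
    rw [star_smul, star_smul (t : ℂ), mulVec_smul, mulVec_smul, mulVec_smul, mulVec_smul] at h1
    simp only [smul_dotProduct, dotProduct_smul] at h1
    rw [e00, e10, e01, e11] at h1
    simp only [RCLike.star_def, Complex.conj_ofReal, smul_eq_mul, RCLike.re_to_complex,
      Complex.add_re, Complex.re_ofReal_mul, Complex.conj_re] at h1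
    change 0 ≤ s * (s * α) + t * (s * β) + (s * (t * β) + t * (t * γ)) at h1
    linarith
  have k1 := key γ (-β)
  have k4 := key 0 1
  have k5 := key 1 (-β)
  by_cases hγ : γ = 0
  · rw [hγ] at k5 ⊢
    by_contra hcon
    have hβ : 0 < β ^ 2 := by nlinarith
    -- With `γ = 0` this choice makes the form equal to `-α - 2`, while `k5` forces `α ≥ 0`.
    have k7 := key 1 (-(α + 1) / β)
    have hβ0 : β ≠ 0 := fun h0 => by rw [h0] at hβ; norm_num at hβ
    rw [hγ] at k7
    have : 2 * (1 * (-(α + 1) / β)) * β = -2 * (α + 1) := by field_simp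
    nlinarith
  · have hγ0 : 0 < γ := lt_of_le_of_ne (by linarith) (Ne.symm hγ)
    have : 0 ≤ γ * (α * γ - β ^ 2) := by nlinarith
    have := nonneg_of_mul_nonneg_right this hγ0
    linarith

end QuantumBipartite

/-! ### An intermediate value principle for set-valued families. -/

/-- An intermediate value principle for a compact family of connected fibres over an interval. -/
theorem exists_mem_fibre_eq_zero {Z : Type*} [TopologicalSpace Z] [T2Space Z] {a b : ℝ} (hab : a ≤ b)
    {F : ℝ → Set Z} (hc : IsCompact {x : ℝ × Z | x.1 ∈ Set.Icc a b ∧ x.2 ∈ F x.1})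
    (hF : ∀ θ, (F θ).Nonempty) (hconn : ∀ θ, IsPreconnected (F θ)) {g : Z → ℝ} (hg : Continuous g)
    {z₀ z₁ : Z} (h₀ : z₀ ∈ F a) (h₁ : z₁ ∈ F b) (hz : g z₁ = -g z₀) :
    ∃ θ, ∃ z ∈ F θ, g z = 0 := by
  have hclosed : ∀ T : Set ℝ, IsClosed T →
      IsClosed {θ | θ ∈ Set.Icc a b ∧ ∃ z ∈ F θ, g z ∈ T} := by
    intro T hT
    have h1 : IsCompact ({x : ℝ × Z | x.1 ∈ Set.Icc a b ∧ x.2 ∈ F x.1} ∩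
        (fun x : ℝ × Z => g x.2) ⁻¹' T) :=
      hc.inter_right (hT.preimage (hg.comp continuous_snd))
    convert (h1.image continuous_fst).isClosed using 1
    ext θ
    constructor
    · rintro ⟨hθ, z, hz, hgz⟩
      exact ⟨(θ, z), ⟨⟨hθ, hz⟩, hgz⟩, rfl⟩
    · rintro ⟨⟨θ', z⟩, ⟨⟨hθ, hz⟩, hgz⟩, rfl⟩
      exact ⟨hθ, z, hz, hgz⟩
  have ha : a ∈ Set.Icc a b := ⟨le_rfl, hab⟩
  have hb : b ∈ Set.Icc a b := ⟨hab, le_rfl⟩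
  have hcover : Set.Icc a b ⊆ {θ | θ ∈ Set.Icc a b ∧ ∃ z ∈ F θ, g z ∈ Set.Ici (0 : ℝ)} ∪
      {θ | θ ∈ Set.Icc a b ∧ ∃ z ∈ F θ, g z ∈ Set.Iic (0 : ℝ)} := by
    intro θ hθ
    obtain ⟨z, hz⟩ := hF θ
    rcases le_total 0 (g z) with h | h
    · exact Or.inl ⟨hθ, z, hz, h⟩
    · exact Or.inr ⟨hθ, z, hz, h⟩
  have hne : (Set.Icc a b ∩ {θ | θ ∈ Set.Icc a b ∧ ∃ z ∈ F θ, g z ∈ Set.Ici (0 : ℝ)}).Nonempty ∧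
      (Set.Icc a b ∩ {θ | θ ∈ Set.Icc a b ∧ ∃ z ∈ F θ, g z ∈ Set.Iic (0 : ℝ)}).Nonempty := by
    rcases le_total 0 (g z₀) with h | h
    · exact ⟨⟨a, ha, ha, z₀, h₀, h⟩, ⟨b, hb, hb, z₁, h₁, by rw [hz]; simpa using h⟩⟩
    · exact ⟨⟨b, hb, hb, z₁, h₁, by rw [hz]; simpa using h⟩, ⟨a, ha, ha, z₀, h₀, h⟩⟩
  -- The parameters with a value `≥ 0` and those with a value `≤ 0` form closed sets, being
  -- projections of compact sets. They cover the interval, hence meet; over a common parameter the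
  -- connected fibre carries a zero.
  obtain ⟨θ, -, ⟨-, z, hz, hgz⟩, ⟨-, z', hz', hgz'⟩⟩ :=
    isPreconnected_closed_iff.1 isPreconnected_Icc _ _ (hclosed _ isClosed_Ici)
      (hclosed _ isClosed_Iic) hcover hne.1 hne.2
  obtain ⟨w, hw, hgw⟩ := (hconn θ).intermediate_value hz' hz hg.continuousOn ⟨hgz', hgz⟩
  exact ⟨θ, w, hw, hgw⟩

/-! ### Unit vectors minimizing a Hermitian form. -/

namespace Matrix

variable {ι : Type*} [Fintype ι]

/-- Unit vectors minimizing the quadratic form of a matrix. -/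
def unitMinimizers (H : Matrix ι ι ℂ) : Set (ι → ℂ) :=
  {u | star u ⬝ᵥ u = 1 ∧
    ∀ w, (star u ⬝ᵥ H *ᵥ u).re * (star w ⬝ᵥ w).re ≤ (star w ⬝ᵥ H *ᵥ w).re}

theorem unitMinimizers_nonempty [DecidableEq ι] [Nonempty ι] {H : Matrix ι ι ℂ}
    (hH : H.IsHermitian) : (unitMinimizers H).Nonempty := by
  obtain ⟨U, hU, hd⟩ := hH.exists_unitary_diagonal
  have hUU : Uᴴ * U = 1 := mem_unitaryGroup_iff'.1 hU
  have hUU' : U * Uᴴ = 1 := mem_unitaryGroup_iff.1 hU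
  obtain ⟨k, hk⟩ := Finite.exists_min hH.eigenvalues
  have hcol : ∀ l, star (fun i => U i k) ⬝ᵥ (fun i => U i l) = if k = l then 1 else 0 := by
    intro l
    rw [← one_apply, ← hUU]
    rfl
  have hform : ∀ z : ι → ℂ, (star z ⬝ᵥ H *ᵥ z).re =
      ∑ l, hH.eigenvalues l * ‖star z ⬝ᵥ fun i => U i l‖ ^ 2 := fun z => by
    rw [← QuantumBipartite.re_form_diagonalization, ← hd]
  have hnorm : ∀ z : ι → ℂ, (star z ⬝ᵥ z).re = ∑ l, ‖star z ⬝ᵥ fun i => U i l‖ ^ 2 := fun z => by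
    have h1 := QuantumBipartite.re_form_diagonalization U (fun _ => (1 : ℝ)) z
    simpa only [Complex.ofReal_one, diagonal_one, Matrix.mul_one, hUU', one_mulVec, one_mul] using h1
  refine ⟨fun i => U i k, by rw [hcol, if_pos rfl], fun w => ?_⟩
  have hval : (star (fun i => U i k) ⬝ᵥ H *ᵥ fun i => U i k).re = hH.eigenvalues k := by
    rw [hform, Finset.sum_eq_single k]
    · rw [hcol, if_pos rfl]; simp
    · intro l _ hl
      rw [hcol, if_neg (Ne.symm hl)]; simp
    · simp
  rw [hval, hform, hnorm, Finset.mul_sum]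
  exact Finset.sum_le_sum fun l _ => mul_le_mul_of_nonneg_right (hk l) (sq_nonneg _)

theorem star_dotProduct_self_eq_ofReal (w : ι → ℂ) : star w ⬝ᵥ w = ((star w ⬝ᵥ w).re : ℂ) := by
  have h : (0 : ℂ) ≤ star w ⬝ᵥ w := dotProduct_star_self_nonneg w
  exact Complex.ext rfl (Complex.nonneg_iff.1 h).2.symm

theorem re_star_dotProduct_self_pos {w : ι → ℂ} (hw : w ≠ 0) : 0 < (star w ⬝ᵥ w).re := by
  have h : (0 : ℂ) ≤ star w ⬝ᵥ w := dotProduct_star_self_nonneg w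
  refine lt_of_le_of_ne (Complex.nonneg_iff.1 h).1 fun h0 => hw ?_
  rw [← dotProduct_star_self_eq_zero, star_dotProduct_self_eq_ofReal, ← h0, Complex.ofReal_zero]

theorem posSemidef_sub_of_mem_unitMinimizers [DecidableEq ι] {H : Matrix ι ι ℂ}
    (hH : H.IsHermitian) {u : ι → ℂ} (hu : u ∈ unitMinimizers H) :
    (H - ((star u ⬝ᵥ H *ᵥ u).re : ℂ) • 1).PosSemidef := by
  have hherm : (H - ((star u ⬝ᵥ H *ᵥ u).re : ℂ) • 1).IsHermitian := by
    refine hH.sub ?_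
    rw [IsHermitian, conjTranspose_smul, conjTranspose_one, RCLike.star_def, Complex.conj_ofReal]
  refine PosSemidef.of_dotProduct_mulVec_nonneg hherm fun w => ?_
  rw [Complex.nonneg_iff]
  refine ⟨?_, (hherm.im_star_dotProduct_mulVec_self w).symm⟩
  rw [sub_mulVec, smul_mulVec, one_mulVec, dotProduct_sub, dotProduct_smul, Complex.sub_re,
    smul_eq_mul, Complex.re_ofReal_mul]
  linarith [hu.2 w]

/-- The minimizers form the unit sphere of a complex eigenspace. A nonzero complex space has real
dimension at least two, so it stays connected without the origin, and normalization maps it onto the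
sphere. -/
theorem isPreconnected_unitMinimizers {H : Matrix ι ι ℂ} (hH : H.IsHermitian) :
    IsPreconnected (unitMinimizers H) := by
  classical
  rcases (unitMinimizers H).eq_empty_or_nonempty with he | ⟨u₀, hu₀⟩
  · rw [he]; exact isPreconnected_empty
  set m := (star u₀ ⬝ᵥ H *ᵥ u₀).re with hm
  have hP := posSemidef_sub_of_mem_unitMinimizers hH hu₀
  rw [← hm] at hP
  let K : Submodule ℂ (ι → ℂ) := LinearMap.ker (mulVecLin (H - (m : ℂ) • 1))
  have hK : ∀ u : ι → ℂ, u ∈ K ↔ (star u ⬝ᵥ H *ᵥ u).re = m * (star u ⬝ᵥ u).re := by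
    intro u
    rw [LinearMap.mem_ker, mulVecLin_apply, ← hP.dotProduct_mulVec_zero_iff, Complex.ext_iff]
    have him := hP.isHermitian.im_star_dotProduct_mulVec_self u
    rw [RCLike.im_to_complex] at him
    rw [him, sub_mulVec, smul_mulVec, one_mulVec, dotProduct_sub, dotProduct_smul, Complex.sub_re,
      smul_eq_mul, Complex.re_ofReal_mul]
    simp [sub_eq_zero]
  have hmem : ∀ u : ι → ℂ, u ∈ unitMinimizers H ↔ star u ⬝ᵥ u = 1 ∧ u ∈ K := by
    intro u
    rw [hK]
    constructor
    · rintro ⟨h1, h2⟩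
      refine ⟨h1, le_antisymm ?_ (hu₀.2 u)⟩
      have := h2 u₀
      rw [hu₀.1, Complex.one_re, mul_one] at this
      rw [h1, Complex.one_re, mul_one]
      exact this
    · rintro ⟨h1, h2⟩
      refine ⟨h1, fun w => ?_⟩
      rw [h2, h1, Complex.one_re, mul_one]
      exact hu₀.2 w
  have hu₀K : u₀ ∈ K := ((hmem u₀).1 hu₀).2
  have hu₀0 : u₀ ≠ 0 := by
    intro h0
    have := hu₀.1
    rw [h0, dotProduct_zero] at this
    exact zero_ne_one this
  have hrank : 1 < Module.rank ℝ K := by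
    have : Nontrivial K := ⟨⟨u₀, hu₀K⟩, 0, fun h => hu₀0 (congrArg Subtype.val h)⟩
    rw [rank_real_of_complex]
    have h1 : (1 : Cardinal) ≤ Module.rank ℂ K := Cardinal.one_le_iff_pos.2 (rank_pos)
    calc (1 : Cardinal) < 2 * 1 := by norm_num
      _ ≤ 2 * Module.rank ℂ K := by gcongr
  have hpre : IsPreconnected ({0}ᶜ : Set K) :=
    (isConnected_compl_singleton_of_one_lt_rank hrank 0).isPreconnected
  let f : K → ι → ℂ := fun w => (((√((star w.1 ⬝ᵥ w.1).re))⁻¹ : ℝ) : ℂ) • w.1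
  have hf : ContinuousOn f {0}ᶜ := by
    refine ContinuousOn.smul (f := fun w : K => (((√((star w.1 ⬝ᵥ w.1).re))⁻¹ : ℝ) : ℂ))
      (g := fun w : K => w.1) ?_ continuous_subtype_val.continuousOn
    refine Complex.continuous_ofReal.comp_continuousOn (ContinuousOn.inv₀ ?_ ?_)
    · refine Continuous.continuousOn ?_
      refine Real.continuous_sqrt.comp (Complex.continuous_re.comp ?_)
      exact (continuous_star.comp continuous_subtype_val).dotProduct continuous_subtype_val
    · intro w hw
      exact (Real.sqrt_pos.2 (re_star_dotProduct_self_pos fun h => hw (Subtype.ext h))).ne'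
  convert hpre.image f hf using 1
  ext u
  rw [hmem]
  constructor
  · rintro ⟨h1, h2⟩
    refine ⟨⟨u, h2⟩, ?_, ?_⟩
    · intro h0
      have h3 : u = 0 := congrArg Subtype.val h0
      rw [h3, dotProduct_zero] at h1
      exact zero_ne_one h1
    · simp [f, h1]
  · rintro ⟨w, hw, rfl⟩
    refine ⟨?_, K.smul_mem _ w.2⟩
    have hpos := re_star_dotProduct_self_pos fun h : w.1 = 0 => hw (Subtype.ext h)
    simp only [f, star_smul, smul_dotProduct, dotProduct_smul, smul_eq_mul, RCLike.star_def,
      Complex.conj_ofReal]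
    rw [star_dotProduct_self_eq_ofReal w.1]
    norm_cast
    rw [← mul_assoc, ← mul_inv, Real.mul_self_sqrt hpos.le, inv_mul_cancel₀ hpos.ne']

/-- Joint closedness in parameter and vector replaces a continuous choice of eigenvectors, which
need not exist. -/
theorem isClosed_unitMinimizers {T : Type*} [TopologicalSpace T] {H : T → Matrix ι ι ℂ}
    (hH : Continuous H) : IsClosed {x : T × (ι → ℂ) | x.2 ∈ unitMinimizers (H x.1)} := by
  have hstar : Continuous fun x : T × (ι → ℂ) => star x.2 := continuous_star.comp continuous_snd
  have h1 : Continuous fun x : T × (ι → ℂ) => star x.2 ⬝ᵥ H x.1 *ᵥ x.2 :=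
    hstar.dotProduct ((hH.comp continuous_fst).matrix_mulVec continuous_snd)
  refine IsClosed.inter (isClosed_eq (hstar.dotProduct continuous_snd) continuous_const) ?_
  change IsClosed {x : T × (ι → ℂ) | ∀ w, (star x.2 ⬝ᵥ H x.1 *ᵥ x.2).re * (star w ⬝ᵥ w).re ≤
      (star w ⬝ᵥ H x.1 *ᵥ w).re}
  rw [Set.ofPred_forall]
  refine isClosed_iInter fun w => isClosed_le ?_ ?_
  · exact (Complex.continuous_re.comp h1).mul continuous_const
  · exact Complex.continuous_re.comp (continuous_const.dotProduct
      ((hH.comp continuous_fst).matrix_mulVec continuous_const))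

theorem unitMinimizers_subset_closedBall (H : Matrix ι ι ℂ) :
    unitMinimizers H ⊆ Metric.closedBall 0 1 := by
  intro u hu
  rw [mem_closedBall_zero_iff, pi_norm_le_iff_of_nonneg zero_le_one]
  intro i
  have h1 : (star u ⬝ᵥ u).re = ∑ j, ‖u j‖ ^ 2 := by
    rw [dotProduct, Complex.re_sum]
    refine Finset.sum_congr rfl fun j _ => ?_
    rw [Pi.star_apply, RCLike.star_def, Complex.conj_mul']
    norm_cast
  rw [hu.1, Complex.one_re] at h1
  have h2 : ‖u i‖ ^ 2 ≤ 1 := by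
    rw [h1]
    exact Finset.single_le_sum (f := fun j => ‖u j‖ ^ 2) (fun j _ => sq_nonneg _)
      (Finset.mem_univ i)
  exact (sq_le_one_iff₀ (norm_nonneg _)).1 h2

end Matrix

/-! ### Balancing the overlaps by rotating the qubit. -/

namespace QuantumBipartite

open Matrix

/-- A real rotation of the qubit basis. -/
noncomputable def qubitRotation (θ : ℝ) : Matrix (Fin 2) (Fin 2) ℂ :=
  !![(Real.cos θ : ℂ), (Real.sin θ : ℂ); -(Real.sin θ : ℂ), (Real.cos θ : ℂ)]

theorem qubitRotation_mem_unitaryGroup (θ : ℝ) : qubitRotation θ ∈ unitaryGroup (Fin 2) ℂ := by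
  rw [mem_unitaryGroup_iff]
  have h : (Real.cos θ : ℂ) * Real.cos θ + Real.sin θ * Real.sin θ = 1 := by
    rw [← sq, ← sq]
    exact_mod_cast Real.cos_sq_add_sin_sq θ
  ext i j
  fin_cases i <;> fin_cases j <;>
    simp [-Complex.ofReal_cos, -Complex.ofReal_sin, qubitRotation, mul_apply, Fin.sum_univ_two,
      star_apply] <;> first | linear_combination h | ring

/-- The matrix `X` in a rotated qubit basis. -/
noncomputable def rotateQubit {n : ℕ} (X : BipartiteMatrix n 2) (θ : ℝ) : BipartiteMatrix n 2 :=
  ((1 : Matrix (Fin n) (Fin n) ℂ) ⊗ₖ qubitRotation θ) * X *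
    star ((1 : Matrix (Fin n) (Fin n) ℂ) ⊗ₖ qubitRotation θ)

theorem one_kronecker_mem_unitaryGroup {n k : ℕ} {R : Matrix (Fin k) (Fin k) ℂ}
    (hR : R ∈ unitaryGroup (Fin k) ℂ) :
    (1 : Matrix (Fin n) (Fin n) ℂ) ⊗ₖ R ∈ unitaryGroup (Fin n × Fin k) ℂ := by
  rw [mem_unitaryGroup_iff, star_eq_conjTranspose, conjTranspose_kronecker, ← mul_kronecker_mul,
    ← star_eq_conjTranspose R, mem_unitaryGroup_iff.1 hR, conjTranspose_one, Matrix.one_mul,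
    one_kronecker_one]

theorem qubitBlock_rotateQubit {n : ℕ} (X : BipartiteMatrix n 2) (θ : ℝ) (s t : Fin 2) :
    qubitBlock (rotateQubit X θ) s t = ∑ s', ∑ t',
      (qubitRotation θ s s' * star (qubitRotation θ t t')) • qubitBlock X s' t' := by
  ext i j
  simp only [rotateQubit, qubitBlock, mul_apply, of_apply, star_apply, Fintype.sum_prod_type,
    Fin.sum_univ_two, kroneckerMap_apply, one_apply, Matrix.add_apply, Matrix.smul_apply, ite_mul,
    one_mul, zero_mul, Finset.sum_add_distrib, Finset.sum_ite_eq, Finset.mem_univ, if_true,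
    apply_ite star, star_zero, mul_ite, mul_zero, smul_eq_mul]
  ring

theorem continuous_rotateQubit {n : ℕ} (X : BipartiteMatrix n 2) : Continuous (rotateQubit X) := by
  have hR : Continuous qubitRotation := by
    refine continuous_matrix fun i j => ?_
    fin_cases i <;> fin_cases j <;> simp [qubitRotation] <;> fun_prop
  have h1 : Continuous fun θ => (1 : Matrix (Fin n) (Fin n) ℂ) ⊗ₖ qubitRotation θ := by
    refine continuous_matrix fun p q => ?_
    exact continuous_const.mul (hR.matrix_elem _ _)
  exact (h1.matrix_mul continuous_const).matrix_mul (continuous_star.comp h1)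

theorem continuous_qubitBlock {n : ℕ} (s t : Fin 2) :
    Continuous fun X : BipartiteMatrix n 2 => qubitBlock X s t :=
  continuous_matrix fun i j => continuous_id.matrix_elem (i, s) (j, t)

theorem rotateQubit_zero {n : ℕ} (X : BipartiteMatrix n 2) (s t : Fin 2) :
    qubitBlock (rotateQubit X 0) s t = qubitBlock X s t := by
  rw [qubitBlock_rotateQubit]
  fin_cases s <;> fin_cases t <;> simp [qubitRotation]

theorem rotateQubit_pi_div_two {n : ℕ} (X : BipartiteMatrix n 2) :
    qubitBlock (rotateQubit X (Real.pi / 2)) 0 0 = qubitBlock X 1 1 ∧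
    qubitBlock (rotateQubit X (Real.pi / 2)) 1 1 = qubitBlock X 0 0 ∧
    qubitBlock (rotateQubit X (Real.pi / 2)) 0 1 = -qubitBlock X 1 0 := by
  simp only [qubitBlock_rotateQubit]
  refine ⟨?_, ?_, ?_⟩ <;>
    simp [-Complex.ofReal_cos, -Complex.ofReal_sin, qubitRotation]

/-- The Hermitian dilation whose minimizers are the top singular pairs of `B`. -/
def singularDilation {n : ℕ} (B : Matrix (Fin n) (Fin n) ℂ) :
    Matrix (Fin n ⊕ Fin n) (Fin n ⊕ Fin n) ℂ :=
  fromBlocks 0 (-B) (-Bᴴ) 0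

theorem isHermitian_singularDilation {n : ℕ} (B : Matrix (Fin n) (Fin n) ℂ) :
    (singularDilation B).IsHermitian := by
  rw [IsHermitian, singularDilation, fromBlocks_conjTranspose]
  simp

theorem re_form_singularDilation {n : ℕ} (B : Matrix (Fin n) (Fin n) ℂ) (x y : Fin n → ℂ) :
    (star (Sum.elim x y) ⬝ᵥ singularDilation B *ᵥ Sum.elim x y).re =
      -2 * (star x ⬝ᵥ B *ᵥ y).re := by
  have h1 : star (Sum.elim x y) = Sum.elim (star x) (star y) := by
    ext i; cases i <;> rfl
  have h2 : star y ⬝ᵥ Bᴴ *ᵥ x = star (star x ⬝ᵥ B *ᵥ y) := by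
    rw [dotProduct_mulVec, ← star_mulVec, star_dotProduct]
  rw [singularDilation, fromBlocks_mulVec, h1, sumElim_dotProduct_sumElim]
  simp only [Sum.elim_comp_inl, Sum.elim_comp_inr, zero_mulVec, zero_add, add_zero, neg_mulVec,
    dotProduct_neg, h2, Complex.add_re, Complex.neg_re, RCLike.star_def, Complex.conj_re]
  ring

theorem star_dotProduct_sumElim {n : ℕ} (x y : Fin n → ℂ) :
    star (Sum.elim x y) ⬝ᵥ Sum.elim x y = star x ⬝ᵥ x + star y ⬝ᵥ y := by
  have h1 : star (Sum.elim x y) = Sum.elim (star x) (star y) := by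
    ext i; cases i <;> rfl
  rw [h1, sumElim_dotProduct_sumElim]

/-- Exchanging the roles of the two factors of a singular pair. -/
theorem sumElim_mem_unitMinimizers_swap {n : ℕ} {B : Matrix (Fin n) (Fin n) ℂ} {x y : Fin n → ℂ}
    (h : Sum.elim x y ∈ unitMinimizers (singularDilation B)) :
    Sum.elim y (-x) ∈ unitMinimizers (singularDilation (-Bᴴ)) := by
  have hadj : ∀ a b : Fin n → ℂ, (star a ⬝ᵥ Bᴴ *ᵥ b).re = (star b ⬝ᵥ B *ᵥ a).re := by
    intro a b
    rw [dotProduct_mulVec, ← star_mulVec, star_dotProduct, RCLike.star_def, Complex.conj_re]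
  obtain ⟨h1, h2⟩ := h
  rw [star_dotProduct_sumElim] at h1
  refine ⟨?_, fun w => ?_⟩
  · rw [star_dotProduct_sumElim, star_neg, neg_dotProduct_neg, add_comm, h1]
  · obtain ⟨a, b, rfl⟩ : ∃ a b, w = Sum.elim a b := ⟨_, _, (Sum.elim_comp_inl_inr w).symm⟩
    -- The inverse exchange `(a, b) ↦ (-b, a)` preserves length and carries the form for `-Bᴴ` to
    -- the form for `B`.
    have h3 := h2 (Sum.elim (-b) a)
    simp only [re_form_singularDilation, star_dotProduct_sumElim, star_neg,
      neg_dotProduct, neg_mulVec, mulVec_neg, dotProduct_neg, neg_neg, Complex.neg_re, hadj,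
      Complex.add_re] at h3 ⊢
    linarith

/-- Some rotation of the qubit basis balances the overlaps of the extremal vectors of the blocks. -/
theorem exists_balanced_rotation {n : ℕ} (hn : 0 < n) {ρ : BipartiteMatrix n 2}
    (hρ : ρ.IsHermitian) : ∃ θ, ∃ u ∈ unitMinimizers (qubitBlock (rotateQubit ρ θ) 0 0),
      ∃ v ∈ unitMinimizers (qubitBlock (rotateQubit ρ θ) 1 1), ∃ x y,
      Sum.elim x y ∈ unitMinimizers (singularDilation (qubitBlock (rotateQubit ρ θ) 0 1)) ∧
      ‖star x ⬝ᵥ u‖ = ‖star y ⬝ᵥ v‖ := by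
  have : Nonempty (Fin n) := ⟨⟨0, hn⟩⟩
  have hM : ∀ θ, (rotateQubit ρ θ).IsHermitian := fun θ =>
    isHermitian_mul_mul_conjTranspose _ hρ
  have hA : ∀ θ s, (qubitBlock (rotateQubit ρ θ) s s).IsHermitian := fun θ s =>
    qubitBlock_conjTranspose (hM θ) s s
  have hcont : ∀ s t, Continuous fun θ => qubitBlock (rotateQubit ρ θ) s t := fun s t =>
    (continuous_qubitBlock s t).comp (continuous_rotateQubit ρ)
  have hcontG : Continuous fun θ => singularDilation (qubitBlock (rotateQubit ρ θ) 0 1) :=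
    Continuous.matrix_fromBlocks continuous_const (hcont 0 1).neg
      (hcont 0 1).matrix_conjTranspose.neg continuous_const
  let F : ℝ → Set ((Fin n → ℂ) × (Fin n → ℂ) × (Fin n ⊕ Fin n → ℂ)) := fun θ =>
    unitMinimizers (qubitBlock (rotateQubit ρ θ) 0 0) ×ˢ
      unitMinimizers (qubitBlock (rotateQubit ρ θ) 1 1) ×ˢ
        unitMinimizers (singularDilation (qubitBlock (rotateQubit ρ θ) 0 1))
  let g : (Fin n → ℂ) × (Fin n → ℂ) × (Fin n ⊕ Fin n → ℂ) → ℝ := fun z =>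
    ‖star (fun i => z.2.2 (Sum.inl i)) ⬝ᵥ z.1‖ - ‖star (fun i => z.2.2 (Sum.inr i)) ⬝ᵥ z.2.1‖
  have hg : Continuous g := by
    have c1 : Continuous fun z : (Fin n → ℂ) × (Fin n → ℂ) × (Fin n ⊕ Fin n → ℂ) =>
        fun i => z.2.2 (Sum.inl i) := by fun_prop
    have c2 : Continuous fun z : (Fin n → ℂ) × (Fin n → ℂ) × (Fin n ⊕ Fin n → ℂ) =>
        fun i => z.2.2 (Sum.inr i) := by fun_prop
    exact ((continuous_star.comp c1).dotProduct continuous_fst).norm.sub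
      ((continuous_star.comp c2).dotProduct (continuous_fst.comp continuous_snd)).norm
  have hcompact : IsCompact {x : ℝ × ((Fin n → ℂ) × (Fin n → ℂ) × (Fin n ⊕ Fin n → ℂ)) |
      x.1 ∈ Set.Icc 0 (Real.pi / 2) ∧ x.2 ∈ F x.1} := by
    refine IsCompact.of_isClosed_subset ((isCompact_Icc (a := (0 : ℝ)) (b := Real.pi / 2)).prod
      ((isCompact_closedBall (0 : Fin n → ℂ) 1).prod ((isCompact_closedBall (0 : Fin n → ℂ) 1).prod
        (isCompact_closedBall (0 : Fin n ⊕ Fin n → ℂ) 1)))) ?_ ?_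
    · refine (isClosed_Icc.preimage continuous_fst).inter (IsClosed.inter ?_ (IsClosed.inter ?_ ?_))
      · exact (isClosed_unitMinimizers (hcont 0 0)).preimage
          (continuous_fst.prodMk (continuous_fst.comp continuous_snd))
      · exact (isClosed_unitMinimizers (hcont 1 1)).preimage
          (continuous_fst.prodMk (continuous_fst.comp (continuous_snd.comp continuous_snd)))
      · exact (isClosed_unitMinimizers hcontG).preimage
          (continuous_fst.prodMk (continuous_snd.comp (continuous_snd.comp continuous_snd)))
    · rintro ⟨θ, u, v, z⟩ ⟨hθ, hu, hv, hz⟩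
      exact ⟨hθ, unitMinimizers_subset_closedBall _ hu, unitMinimizers_subset_closedBall _ hv,
        unitMinimizers_subset_closedBall _ hz⟩
  have hne : ∀ θ, (F θ).Nonempty := fun θ =>
    (unitMinimizers_nonempty (hA θ 0)).prod ((unitMinimizers_nonempty (hA θ 1)).prod
      (unitMinimizers_nonempty (isHermitian_singularDilation _)))
  have hconn : ∀ θ, IsPreconnected (F θ) := fun θ =>
    (isPreconnected_unitMinimizers (hA θ 0)).prod ((isPreconnected_unitMinimizers (hA θ 1)).prod
      (isPreconnected_unitMinimizers (isHermitian_singularDilation _)))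
  obtain ⟨⟨u, v, z⟩, hu, hv, hz⟩ := hne 0
  obtain ⟨x, y, rfl⟩ : ∃ a b, z = Sum.elim a b := ⟨_, _, (Sum.elim_comp_inl_inr z).symm⟩
  -- A quarter turn exchanges the diagonal blocks and replaces `B` by `-Bᴴ`, so swapping the vectors
  -- of the fibre over `0` gives a point over `π/2`.
  have h₁ : (v, u, Sum.elim y (-x)) ∈ F (Real.pi / 2) := by
    obtain ⟨r00, r11, r01⟩ := rotateQubit_pi_div_two ρ
    simp only [rotateQubit_zero] at hu hv hz
    refine ⟨?_, ?_, ?_⟩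
    · rw [r00]; exact hv
    · rw [r11]; exact hu
    · rw [r01, ← qubitBlock_conjTranspose hρ 0 1]
      exact sumElim_mem_unitMinimizers_swap hz
  have hgz : g (v, u, Sum.elim y (-x)) = -g (u, v, Sum.elim x y) := by
    have e1 : (fun i => (-x) i) = -x := rfl
    simp only [g, Sum.elim_inl, Sum.elim_inr]
    rw [e1, star_neg, neg_dotProduct, norm_neg, neg_sub]
  obtain ⟨θ, ⟨u', v', z'⟩, ⟨hu', hv', hz'⟩, hg0⟩ := exists_mem_fibre_eq_zero
    (by positivity : (0 : ℝ) ≤ Real.pi / 2) hcompact hne hconn hg (z₀ := (u, v, Sum.elim x y))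
    ⟨hu, hv, hz⟩ h₁ hgz
  refine ⟨θ, u', hu', v', hv', fun i => z' (Sum.inl i), fun i => z' (Sum.inr i), ?_,
    sub_eq_zero.1 hg0⟩
  have : Sum.elim (fun i => z' (Sum.inl i)) (fun i => z' (Sum.inr i)) = z' :=
    Sum.elim_comp_inl_inr z'
  rw [this]
  exact hz'

/-! ### From absolutely PPT to separable. -/

/-- With balanced overlaps, an absolutely PPT state lies in the separable cone. -/
theorem mem_sepCone_of_balanced {n : ℕ} {ρ : BipartiteMatrix n 2} (h : ρ ∈ APPT n 2)
    {u v x y : Fin n → ℂ} (hu : u ∈ unitMinimizers (qubitBlock ρ 0 0))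
    (hv : v ∈ unitMinimizers (qubitBlock ρ 1 1))
    (hxy : Sum.elim x y ∈ unitMinimizers (singularDilation (qubitBlock ρ 0 1)))
    (hm : ‖star x ⬝ᵥ u‖ = ‖star y ⬝ᵥ v‖) : ρ ∈ sepCone n 2 := by
  have hherm := h.1.1.isHermitian
  have hblock : ∀ s, (qubitBlock ρ s s).PosSemidef := fun s =>
    h.1.1.submatrix (fun i : Fin n => (i, s))
  set a := (star u ⬝ᵥ qubitBlock ρ 0 0 *ᵥ u).re with ha
  set c := (star v ⬝ᵥ qubitBlock ρ 1 1 *ᵥ v).re with hc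
  have ha0 : 0 ≤ a := (hblock 0).re_dotProduct_nonneg u
  have hc0 : 0 ≤ c := (hblock 1).re_dotProduct_nonneg v
  set b := (star x ⬝ᵥ qubitBlock ρ 0 1 *ᵥ y).re with hb
  have hmax : ∀ p q : Fin n → ℂ, 2 * (star p ⬝ᵥ qubitBlock ρ 0 1 *ᵥ q).re ≤
      2 * b * ((star p ⬝ᵥ p).re + (star q ⬝ᵥ q).re) := by
    intro p q
    have h1 := hxy.2 (Sum.elim p q)
    rw [re_form_singularDilation, re_form_singularDilation, star_dotProduct_sumElim,
      Complex.add_re] at h1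
    linarith
  have hxy1 : (star x ⬝ᵥ x).re + (star y ⬝ᵥ y).re = 1 := by
    have := hxy.1
    rw [star_dotProduct_sumElim] at this
    rw [← Complex.add_re, this, Complex.one_re]
  have hN : ∀ p : Fin n → ℂ, 0 ≤ (star p ⬝ᵥ p).re := fun p =>
    (Complex.nonneg_iff.1 (dotProduct_star_self_nonneg p)).1
  -- The concatenated vector `(x, y)` has length one, so `2b` plays the role of the top singular
  -- value of `B`. For `b > 0` both halves have squared length `1/2`, and scaling them by `√2` gives
  -- the unit vectors needed.
  have hb2 : 2 * b ≤ √a * √c := by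
    rcases le_or_gt b 0 with hb0 | hb0
    · exact le_trans (by linarith) (mul_nonneg (Real.sqrt_nonneg a) (Real.sqrt_nonneg c))
    have hquad : ∀ s t : ℝ, s * t ≤ s ^ 2 * (star x ⬝ᵥ x).re + t ^ 2 * (star y ⬝ᵥ y).re := by
      intro s t
      have h1 := hmax ((s : ℂ) • x) ((t : ℂ) • y)
      simp only [star_smul, smul_dotProduct, mulVec_smul, dotProduct_smul, smul_eq_mul,
        RCLike.star_def, Complex.conj_ofReal, Complex.re_ofReal_mul, ← hb] at h1
      have h2 : (2 * b) * (s * t) ≤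
          (2 * b) * (s ^ 2 * (star x ⬝ᵥ x).re + t ^ 2 * (star y ⬝ᵥ y).re) := by linarith
      exact le_of_mul_le_mul_left h2 (by linarith)
    -- For the squared lengths `X`, `Y` the two choices give `Y ≤ 4XY²` and `X ≤ 4X²Y`. Adding them,
    -- `X + Y = 1` yields `4XY ≥ 1`, hence `X = Y`.
    have q1 := hquad (2 * (star y ⬝ᵥ y).re) 1
    have q2 := hquad 1 (2 * (star x ⬝ᵥ x).re)
    have hX : (star x ⬝ᵥ x).re = 1 / 2 := by
      have hy' : (star y ⬝ᵥ y).re = 1 - (star x ⬝ᵥ x).re := by linarith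
      rw [hy'] at q1 q2
      nlinarith
    have hY : (star y ⬝ᵥ y).re = 1 / 2 := by linarith
    have h22 : ((√2 : ℝ) : ℂ) * ((√2 : ℝ) : ℂ) = 2 := by
      rw [← Complex.ofReal_mul, Real.mul_self_sqrt (by norm_num)]; norm_num
    have hunit : ∀ p : Fin n → ℂ, (star p ⬝ᵥ p).re = 1 / 2 →
        star (((√2 : ℝ) : ℂ) • p) ⬝ᵥ (((√2 : ℝ) : ℂ) • p) = 1 := by
      intro p hp
      rw [star_smul, smul_dotProduct, dotProduct_smul, star_dotProduct_self_eq_ofReal, hp,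
        RCLike.star_def, Complex.conj_ofReal, smul_smul, h22]
      norm_num
    have key := sq_re_offDiag_le_of_mem_APPT h (hunit x hX) (hunit y hY) hu.1 hv.1 (by
      rw [star_smul, star_smul, smul_dotProduct, smul_dotProduct, norm_smul, norm_smul, hm])
    rw [star_smul, smul_dotProduct, mulVec_smul, dotProduct_smul, RCLike.star_def,
      Complex.conj_ofReal, smul_smul, h22, smul_eq_mul, ← ha, ← hc] at key
    have hre : (2 * (star x ⬝ᵥ qubitBlock ρ 0 1 *ᵥ y)).re = 2 * b := by
      rw [Complex.mul_re]; simp [hb]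
    rw [hre] at key
    rw [← Real.sqrt_mul ha0]
    exact Real.le_sqrt_of_sq_le key
  refine mem_sepCone_of_offDiag_le hherm ha0 hc0
    (posSemidef_sub_of_mem_unitMinimizers (hblock 0).isHermitian hu)
    (posSemidef_sub_of_mem_unitMinimizers (hblock 1).isHermitian hv) fun p q => ?_
  exact (hmax p q).trans (mul_le_mul_of_nonneg_right hb2 (add_nonneg (hN p) (hN q)))

/-- Being absolutely PPT survives the rotation that balances the overlaps, and the separable cone is
stable under the inverse rotation, which acts on the qubit alone. -/
theorem mem_SEP_of_mem_APPT {n : ℕ} (hn : 0 < n) {ρ : BipartiteMatrix n 2} (h : ρ ∈ APPT n 2) :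
    ρ ∈ SEP n 2 := by
  obtain ⟨θ, u, hu, v, hv, x, y, hxy, hm⟩ := exists_balanced_rotation hn h.1.1.isHermitian
  have hU := one_kronecker_mem_unitaryGroup (n := n) (qubitRotation_mem_unitaryGroup θ)
  have hcone : rotateQubit ρ θ ∈ sepCone n 2 :=
    mem_sepCone_of_balanced (conj_mem_absolutely h hU) hu hv hxy hm
  refine mem_SEP_of_mem_sepCone hn two_pos ?_ h.1.2
  have h1 := conj_mem_sepCone hcone (qubitRotation θ)ᴴ
  have h2 : (1 : Matrix (Fin n) (Fin n) ℂ) ⊗ₖ (qubitRotation θ)ᴴ =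
      star ((1 : Matrix (Fin n) (Fin n) ℂ) ⊗ₖ qubitRotation θ) := by
    rw [star_eq_conjTranspose, conjTranspose_kronecker, conjTranspose_one]
  rw [h2, ← star_eq_conjTranspose, star_star, rotateQubit] at h1
  set V := (1 : Matrix (Fin n) (Fin n) ℂ) ⊗ₖ qubitRotation θ
  have hVV : star V * V = 1 := mem_unitaryGroup_iff'.1 hU
  have h3 : star V * (V * ρ * star V) * V = (star V * V) * ρ * (star V * V) := by
    simp only [Matrix.mul_assoc]
  rwa [h3, hVV, Matrix.one_mul, Matrix.mul_one] at h1

theorem absolutely_mono {n k : ℕ} {S T : Set (BipartiteMatrix n k)} (h : S ⊆ T) :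
    absolutely S ⊆ absolutely T :=
  fun _ hρ => ⟨hρ.1, fun U hU => h (hρ.2 U hU)⟩

end QuantumBipartite

open QuantumBipartite in
theorem mainTheorem6 (n : ℕ) (hn : 2 ≤ n) (ρ : BipartiteMatrix n 2)
    (hρ : ρ ∈ densityMatrices (Fin n × Fin 2))
    (ev : Fin (2 * n) → ℝ) (hev : IsOrderedSpectrum ρ ev) :
    List.TFAE [
      ρ ∈ ASEP n 2,
      ρ ∈ APPT n 2,
      ρ ∈ ARED n 2,
      ev ⟨0, by omega⟩ ≤ ev ⟨2 * n - 2, by omega⟩ +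
        2 * Real.sqrt (ev ⟨2 * n - 3, by omega⟩ * ev ⟨2 * n - 1, by omega⟩)] := by
  tfae_have 1 → 2 := fun h => absolutely_mono (SEP_subset_PPT n 2) h
  tfae_have 2 → 1 := fun h =>
    ⟨h.1, fun U hU => mem_SEP_of_mem_APPT (by omega) (conj_mem_absolutely h hU)⟩
  tfae_have 2 ↔ 3 := by rw [APPT, ARED, RED_eq_PPT]
  tfae_have 2 → 4 := fun h => spectrum_le_of_mem_APPT hn hev h rfl rfl rfl rfl
  -- The inequality depends only on the spectrum, which every conjugate `U ρ U*` shares.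
  tfae_have 4 → 2 := fun h => ⟨hρ, fun U hU =>
    have hd := conj_mem_densityMatrices hρ hU
    ⟨hd, posSemidef_transpose_of_spectrum hn hd.1 (hev.conj hU) rfl rfl rfl rfl h⟩⟩
  tfae_finish
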